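/- **Setting.** Let $\xi=(\xi_n)_{n\ge 1}$ be an i.i.d. sequence of random variables on a probability space $(\Omega,\mathscr A,\mathbf P)$ (the environment). To each value $e$ of the environment there corresponds, measurably, the law $\mathcal L(e)$ of a (locally finite) point process on $\mathbb R$; write $\mathcal L_n=\mathcal L(\xi_n)$, and let $L_n$ have law $\mathcal L_n$ given $\xi$. Let $\mathbb P_\xi,\mathbb E_\xi$ denote quenched probability and expectation, and $\mathbb P(\cdot)=\int\mathbb P_\xi(\cdot)\,d\mathbf P$, with expectation $\mathbb E$. Assume * $\mathbb P_\xi(L_1(\mathbb R)\ge 1)=1$ $\mathbf P$-a.s.; $\mathbf P\big[\mathbb P_\xi(L_1(\mathbb R)>1)>0\big]>0$; $\mathbb E_\xi\big[\sum_{x\in L_1}\mathbf 1_{\{x>0\}}e^{-x}\big]>0$ $\mathbf P$-a.s.; * $\mathbb E_\xi\big[\sum_{x\in L_1}e^{-x}\big]=1$ and $\mathbb E_\xi\big[\sum_{x\in L_1}xe^{-x}\big]=0$ $\mathbf P$-a.s.; * $\mathbb E\big[\sum_{x\in L_1}|x|^{2+\delta}e^{-x}\big]<\infty$ for some $\delta>0$.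 Let $\mu_n(B)=\mathbb E_\xi\big[\sum_{x\in L_n}\mathbf 1_{\{x\in B\}}e^{-x}\big]$, which is $\mathbf P$-a.s. a probability measure. Under $\mathbb P_\xi$ let $X_1,X_2,\dots$ be independent with $X_n\sim\mu_n$, and for a starting point $a\in\mathbb R$ let $S_n=a+X_1+\dots+X_n$ under $\mathbb P_{\xi,a}$, with $\mathbb P_\xi=\mathbb P_{\xi,0}$. For $y\ge 0$ let $\tau_y=\inf\{n\ge 1: y+S_n<0\}$, $U(\xi,y)=-\mathbb E_\xi[S_{\tau_y}]$ and $U(0)=\mathbf E[U(\xi,0)]$. Let $\theta\xi=(\xi_2,\xi_3,\dots)$. Under $\mathbb P_\xi$ let $(\zeta_n)_{n\ge 0}$ be the walk started at $\zeta_0=0$ and conditioned to stay non-negative, that is, the time-inhomogeneous Markov chain whose transition at time $n$ is $\mathbb P^+_{\theta^n\xi}(\zeta_n;dy)$, where $$\mathbb P^+_{\xi}(x;dy)=\frac{U(\theta\xi,y)\mathbf 1_{\{y\ge 0\}}}{U(\xi,x)}\,\mathbb P_{\xi,x}(S_1\in dy),\qquad x\ge 0 .$$ Let $\nu=\inf\{m\ge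 1:\zeta_{m+n}\ge\zeta_m\text{ for all }n\ge 0\}$, and define $$\tilde{\mathbb P}(\cdot)=\int_\Omega\frac{U(\xi,0)}{U(0)}\,\mathbb P_\xi(\cdot)\,d\mathbf P ,$$ with expectation $\tilde{\mathbb E}$. Finally let $\mu^\infty=\prod_{n\ge 1}\mathbf E(\mu_n)$; under $\mu^\infty$ the walk $S_n=X_1+\dots+X_n$, $S_0=0$, has i.i.d. steps. Let $\Gamma_1=\inf\{n>0:S_n\ge 0\}$ be its first weak ascending ladder epoch. **Proposition (Annealed excursion distribution).** One has $0<U(0)<\infty$, $\tilde{\mathbb P}$ is a probability measure, $\nu<\infty$ $\tilde{\mathbb P}$-a.s. and $\Gamma_1<\infty$ $\mu^\infty$-a.s. Moreover: 1. $\tilde{\mathbb P}(\zeta_\nu\in dx)=\mu^\infty(S_{\Gamma_1}\in dx)$. 2. The random finite sequences $(\nu,\zeta_1,\dots,\zeta_\nu)$ under $\tilde{\mathbb P}$ and $(\Gamma_1,\,S_{\Gamma_1}-S_{\Gamma_1-1},\,S_{\Gamma_1}-S_{\Gamma_1-2},\dots,\,S_{\Gamma_1}-S_1,\,S_{\Gamma_1})$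 under $\mu^\infty$ have the same law. That is, for every measurable $f$ with values in $[0,\infty]$, and for every real-valued measurable $f$ for which one of the two sides is integrable (then so is the other), $$\tilde{\mathbb E}\big[f(\nu,\zeta_1,\dots,\zeta_\nu)\big]=\mathbb E_{\mu^\infty}\big[f(\Gamma_1,S_{\Gamma_1}-S_{\Gamma_1-1},\dots,S_{\Gamma_1})\big].$$ -/

import Mathlib

open MeasureTheory ProbabilityTheory
open scoped ENNReal

noncomputable section

namespace RWRE

/-! ### First times, random walk paths, excursions -/

/-- `firstTime p` is `inf {n : p n}`, with the convention `inf ∅ = ∞`. -/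
def firstTime (p : ℕ → Prop) : ℕ∞ := ⨅ (n : ℕ) (_ : p n), (n : ℕ∞)

/-- The path `S_n = X_1 + ⋯ + X_n` (started at `S_0 = 0`) of a step sequence; the entry `X i` is the
`(i+1)`-st step. -/
def walk (X : ℕ → ℝ) (n : ℕ) : ℝ := ∑ i ∈ Finset.range n, X i

/-- `τ_y = inf {n ≥ 1 : y + S_n < 0}`. -/
def tau (y : ℝ) (X : ℕ → ℝ) : ℕ∞ := firstTime fun n => 1 ≤ n ∧ y + walk X n < 0

/-- `Γ₁ = inf {n > 0 : S_n ≥ S_0}`: the first weak ascending ladder epoch of the path `S`. -/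
def ladderEpoch (S : ℕ → ℝ) : ℕ∞ := firstTime fun n => 0 < n ∧ S 0 ≤ S n

/-- `ν = inf {m ≥ 1 : ζ_{m+n} ≥ ζ_m for all n ≥ 0}`: the time of the first prospective minimal
value of the path `ζ`. -/
def prospectiveMin (ζ : ℕ → ℝ) : ℕ∞ := firstTime fun m => 1 ≤ m ∧ ∀ n, ζ m ≤ ζ (m + n)

/-- Finite real sequences `(k, x_1, …, x_k)`, with the disjoint union σ-algebra. -/
abbrev FinSeq : Type := Σ k : ℕ, Fin k → ℝ

/-- `(ν, ζ_1, …, ζ_ν)`. When `ν = ∞` the value is the empty sequence. -/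
def preMinExcursion (ζ : ℕ → ℝ) : FinSeq :=
  ⟨(prospectiveMin ζ).toNat, fun j => ζ ((j : ℕ) + 1)⟩

/-- `(Γ₁, S_{Γ₁} - S_{Γ₁-1}, S_{Γ₁} - S_{Γ₁-2}, …, S_{Γ₁} - S_0)`; the last entry is `S_{Γ₁}` when
`S_0 = 0`. When `Γ₁ = ∞` the value is the empty sequence. -/
def reversedLadderExcursion (S : ℕ → ℝ) : FinSeq :=
  ⟨(ladderEpoch S).toNat,
    fun j => S (ladderEpoch S).toNat - S ((ladderEpoch S).toNat - ((j : ℕ) + 1))⟩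

lemma firstTime_eq_coe_iff (p : ℕ → Prop) (n : ℕ) :
    firstTime p = n ↔ p n ∧ ∀ m < n, ¬ p m := by
  constructor
  · intro h
    have hlow : ∀ m < n, ¬ p m := by
      intro m hm hp
      have h1 : firstTime p ≤ m := iInf₂_le m hp
      rw [h] at h1
      exact absurd (Nat.cast_le.1 h1) (not_le.2 hm)
    refine ⟨?_, hlow⟩
    by_contra hn
    have h2 : ((n + 1 : ℕ) : ℕ∞) ≤ firstTime p := by
      refine le_iInf₂ fun m hm => ?_
      rw [Nat.cast_le]
      by_contra hlt
      rcases Nat.lt_or_ge m n with h3 | h3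
      · exact hlow m h3 hm
      · have : m = n := by omega
        exact hn (this ▸ hm)
    rw [h, Nat.cast_le] at h2
    omega
  · rintro ⟨hn, hlow⟩
    refine le_antisymm (iInf₂_le n hn) (le_iInf₂ fun m hm => ?_)
    rw [Nat.cast_le]
    by_contra hlt
    exact hlow m (not_le.1 hlt) hm

lemma measurable_firstTime {α : Type*} [MeasurableSpace α] {p : α → ℕ → Prop}
    (hp : ∀ n, MeasurableSet {a | p a n}) : Measurable fun a => firstTime (p a) := by
  have hfin : ∀ n : ℕ, MeasurableSet {a | firstTime (p a) = n} := by
    intro n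
    simp only [firstTime_eq_coe_iff]
    refine (hp n).inter ?_
    have : {a | ∀ m < n, ¬ p a m} = ⋂ (m : ℕ) (_ : m < n), {a | p a m}ᶜ := by
      ext a; simp
    rw [Set.ofPred] at *
    exact this ▸ MeasurableSet.iInter fun m => MeasurableSet.iInter fun _ => (hp m).compl
  refine measurable_to_countable' fun t => ?_
  induction t using ENat.recTopCoe with
  | coe n => exact hfin n
  | top =>
    have : (fun a => firstTime (p a)) ⁻¹' {⊤} = (⋃ n : ℕ, {a | firstTime (p a) = n})ᶜ := by
      ext a
      simp only [Set.mem_preimage, Set.mem_singleton_iff, Set.mem_compl_iff, Set.mem_iUnion]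
      constructor
      · intro h ⟨n, hn⟩
        have hn' : firstTime (p a) = n := hn
        rw [h] at hn'
        exact ENat.top_ne_natCast n hn'
      · intro h
        by_contra hne
        obtain ⟨n, hn⟩ := ENat.ne_top_iff_exists.1 hne
        exact h ⟨n, hn.symm⟩
    rw [this]
    exact (MeasurableSet.iUnion hfin).compl

lemma measurable_walk (n : ℕ) : Measurable fun X : ℕ → ℝ => walk X n := by
  unfold walk; fun_prop

lemma measurable_tau : Measurable fun q : ℝ × (ℕ → ℝ) => tau q.1 q.2 := by
  refine measurable_firstTime fun n => ?_
  refine MeasurableSet.inter (MeasurableSet.const _) ?_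
  exact measurableSet_lt (measurable_fst.add ((measurable_walk n).comp measurable_snd))
    measurable_const

/-- `-S_{τ_y}` on `{τ_y < ∞}`, as an extended non-negative number, and `0` on `{τ_y = ∞}`.
For `y ≥ 0` one has `S_{τ_y} < -y ≤ 0`, so that nothing is truncated. -/
def negExit (y : ℝ) (X : ℕ → ℝ) : ℝ≥0∞ :=
  if tau y X = ⊤ then 0 else ENNReal.ofReal (-(walk X (tau y X).toNat))

lemma measurable_negExit : Measurable fun q : ℝ × (ℕ → ℝ) => negExit q.1 q.2 := by
  refine Measurable.ite (measurable_tau (measurableSet_singleton _)) measurable_const ?_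
  refine ENNReal.measurable_ofReal.comp (Measurable.neg ?_)
  have h : Measurable fun r : ℕ × (ℕ → ℝ) => walk r.2 r.1 :=
    measurable_from_prod_countable_right fun n => measurable_walk n
  have hn : Measurable fun q : ℝ × (ℕ → ℝ) => (tau q.1 q.2).toNat :=
    (measurable_from_top (f := ENat.toNat)).comp measurable_tau
  exact h.comp (hn.prodMk measurable_snd)

/-! ### Point processes and the step laws -/

/-- `L` is the counting measure of a locally finite point configuration on `ℝ` (with
multiplicities). -/
def IsPointMeasure (L : Measure ℝ) : Prop :=
  IsLocallyFiniteMeasure L ∧ ∀ B, MeasurableSet B → ∃ k : ℕ∞, L B = (k : ℝ≥0∞)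

/-- The kernel sending a configuration `L` to the weighted measure `∑_{x ∈ L} e^{-x} δ_x`. -/
def weighted : Kernel (Measure ℝ) ℝ where
  toFun L := L.withDensity fun x => ENNReal.ofReal (Real.exp (-x))
  measurable' := by
    refine Measure.measurable_of_measurable_coe _ fun s hs => ?_
    simp only [withDensity_apply _ hs, ← lintegral_indicator hs]
    exact Measure.measurable_lintegral
      (Measurable.indicator (by fun_prop) hs)

variable {E : Type*} [MeasurableSpace E]

/-- For point process laws `𝓛 e` this is the measure
`μ_e(B) = E_{𝓛 e} [∑_{x ∈ L} 1_{x ∈ B} e^{-x}]`. -/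
def tiltedIntensity (𝓛 : Kernel E (Measure ℝ)) : Kernel E ℝ := weighted ∘ₖ 𝓛

lemma measurableSet_total_mass_eq_one {α β : Type*} [MeasurableSpace α] [MeasurableSpace β]
    (κ : Kernel α β) : MeasurableSet {a | κ a Set.univ = 1} :=
  κ.measurable_coe MeasurableSet.univ (measurableSet_singleton 1)

open Classical in
/-- `κ` where it is a probability measure, the point mass at `0` elsewhere. It is only applied to
kernels which are probability measures at almost all relevant points. -/
def probPart {α : Type*} [MeasurableSpace α] (κ : Kernel α ℝ) : Kernel α ℝ :=
  Kernel.piecewise (measurableSet_total_mass_eq_one κ) κ (Kernel.const α (Measure.dirac 0))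

instance {α : Type*} [MeasurableSpace α] (κ : Kernel α ℝ) : IsMarkovKernel (probPart κ) := by
  classical
  refine ⟨fun a => ?_⟩
  rw [probPart, Kernel.piecewise_apply]
  split_ifs with h
  · exact ⟨h⟩
  · rw [Kernel.const_apply]; infer_instance

/-- The law of a step of the walk in the environment `e`. -/
def stepLaw (𝓛 : Kernel E (Measure ℝ)) : Kernel E ℝ := probPart (tiltedIntensity 𝓛)

instance (𝓛 : Kernel E (Measure ℝ)) : IsMarkovKernel (stepLaw 𝓛) := by
  unfold stepLaw; infer_instance

/-- The quenched law of the steps `X_1, X_2, …` given the environment sequence `e`: independent,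
the step number `n + 1` having law `stepLaw 𝓛 (e n)`. -/
def quenchedSteps (𝓛 : Kernel E (Measure ℝ)) : Kernel (ℕ → E) (ℕ → ℝ) where
  toFun e := Measure.infinitePi fun n => stepLaw 𝓛 (e n)
  measurable' := by
    refine Measurable.measure_of_isPiSystem_of_isProbabilityMeasure
      (generateFrom_squareCylinders (ι := ℕ) (α := fun _ => ℝ)).symm
      (isPiSystem_squareCylinders (fun _ => MeasurableSpace.isPiSystem_measurableSet)
        fun _ => Set.mem_ofPred_eq ▸ MeasurableSet.univ) ?_
    rintro _ ⟨s, t, ht, rfl⟩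
    have ht' : ∀ i ∈ s, MeasurableSet (t i) := fun i _ => ht i (Set.mem_univ i)
    simp only [Measure.infinitePi_pi _ ht']
    exact Finset.measurable_prod _ fun i hi =>
      ((stepLaw 𝓛).measurable_coe (ht' i hi)).comp (measurable_pi_apply i)

instance (𝓛 : Kernel E (Measure ℝ)) : IsMarkovKernel (quenchedSteps 𝓛) :=
  ⟨fun e => inferInstanceAs
    (IsProbabilityMeasure (Measure.infinitePi fun n => stepLaw 𝓛 (e n)))⟩

/-! ### The quenched harmonic function and the conditioned walk -/

/-- `U(e, y) = -E_e [S_{τ_y}]`, for `y ≥ 0`. -/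
def harmonicU (𝓛 : Kernel E (Measure ℝ)) (e : ℕ → E) (y : ℝ) : ℝ≥0∞ :=
  ∫⁻ X, negExit y X ∂(quenchedSteps 𝓛 e)

lemma measurable_harmonicU (𝓛 : Kernel E (Measure ℝ)) :
    Measurable fun q : (ℕ → E) × ℝ => harmonicU 𝓛 q.1 q.2 := by
  have hm : Measurable fun r : ((ℕ → E) × ℝ) × (ℕ → ℝ) => negExit r.1.2 r.2 := by
    have hg : Measurable fun r : ((ℕ → E) × ℝ) × (ℕ → ℝ) => (r.1.2, r.2) := by fun_prop
    have hc := measurable_negExit.comp hg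
    simpa only [Function.comp_def] using hc
  exact Measurable.lintegral_kernel_prod_right'
    (κ := (quenchedSteps 𝓛).comap (Prod.fst : (ℕ → E) × ℝ → (ℕ → E)) measurable_fst) hm

/-- The shift `θ e = (e_2, e_3, …)`. -/
def shift (e : ℕ → E) : ℕ → E := fun n => e (n + 1)

lemma measurable_shift : Measurable (shift : (ℕ → E) → (ℕ → E)) :=
  measurable_pi_lambda _ fun n => measurable_pi_apply (n + 1)

/-- The one-step transition of the walk: `(e, x) ↦ P_{e, x}(S_1 ∈ dy)`. -/
def walkStep (𝓛 : Kernel E (Measure ℝ)) : Kernel ((ℕ → E) × ℝ) ℝ :=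
  ((Kernel.id : Kernel ((ℕ → E) × ℝ) _) ×ₖ
    (stepLaw 𝓛).comap (fun q : (ℕ → E) × ℝ => q.1 0)
      ((measurable_pi_apply 0).comp measurable_fst)).map fun r => r.1.2 + r.2

instance (𝓛 : Kernel E (Measure ℝ)) : IsMarkovKernel (walkStep 𝓛) := by
  unfold walkStep
  exact Kernel.IsMarkovKernel.map _ (by fun_prop)

/-- The density `U(θe, y) 1_{y ≥ 0} / U(e, x)` of the `h`-transform. -/
def hDensity (𝓛 : Kernel E (Measure ℝ)) (q : (ℕ → E) × ℝ) (y : ℝ) : ℝ≥0∞ :=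
  (if 0 ≤ y then harmonicU 𝓛 (shift q.1) y else 0) / harmonicU 𝓛 q.1 q.2

lemma measurable_hDensity (𝓛 : Kernel E (Measure ℝ)) :
    Measurable (Function.uncurry (hDensity 𝓛)) := by
  have h1 : Measurable fun r : ((ℕ → E) × ℝ) × ℝ => harmonicU 𝓛 (shift r.1.1) r.2 := by
    have hg : Measurable fun r : ((ℕ → E) × ℝ) × ℝ => (shift r.1.1, r.2) :=
      (measurable_shift.comp (measurable_fst.comp measurable_fst)).prodMk measurable_snd
    have hc := (measurable_harmonicU 𝓛).comp hg
    simpa only [Function.comp_def] using hc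
  have h2 : Measurable fun r : ((ℕ → E) × ℝ) × ℝ => harmonicU 𝓛 r.1.1 r.1.2 :=
    (measurable_harmonicU 𝓛).comp measurable_fst
  have h3 : MeasurableSet {r : ((ℕ → E) × ℝ) × ℝ | 0 ≤ r.2} :=
    measurableSet_le measurable_const measurable_snd
  exact (Measurable.ite h3 h1 measurable_const).div h2

/-- The transition kernel of the walk conditioned to stay non-negative:
`P⁺_e(x; dy) = U(θe, y) 1_{y ≥ 0} / U(e, x) · P_{e, x}(S_1 ∈ dy)`. -/
def condStep (𝓛 : Kernel E (Measure ℝ)) : Kernel ((ℕ → E) × ℝ) ℝ :=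
  probPart (Kernel.withDensity (walkStep 𝓛) (hDensity 𝓛))

instance (𝓛 : Kernel E (Measure ℝ)) : IsMarkovKernel (condStep 𝓛) := by
  unfold condStep; infer_instance

/-- The transition `(e, x) ↦ (θe, y)`, where `y` has law `P⁺_e(x; dy)`. -/
def envCondStep (𝓛 : Kernel E (Measure ℝ)) :
    Kernel ((ℕ → E) × ℝ) ((ℕ → E) × ℝ) :=
  (Kernel.deterministic (fun q : (ℕ → E) × ℝ => shift q.1)
    (measurable_shift.comp measurable_fst)) ×ₖ condStep 𝓛

instance (𝓛 : Kernel E (Measure ℝ)) : IsMarkovKernel (envCondStep 𝓛) := by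
  unfold envCondStep; infer_instance

/-- The law of the Markov chain `(θⁿe, ζ_n)_{n ≥ 0}` with transition `envCondStep`, as a kernel
from the starting point. -/
def envCondChain (𝓛 : Kernel E (Measure ℝ)) :
    Kernel ((ℕ → E) × ℝ) (ℕ → (ℕ → E) × ℝ) :=
  (Kernel.traj (X := fun _ : ℕ => (ℕ → E) × ℝ)
    (fun n => (envCondStep 𝓛).comap
      (fun h : (i : Finset.Iic n) → (ℕ → E) × ℝ => h ⟨n, Finset.mem_Iic.2 le_rfl⟩)
      (measurable_pi_apply _)) 0).comap
    (fun q (_ : Finset.Iic 0) => q) (measurable_pi_lambda _ fun _ => measurable_id)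

/-- The quenched law of `(ζ_n)_{n ≥ 0}`, the walk in the environment `e` started at `0` and
conditioned to stay non-negative: the time-inhomogeneous Markov chain with `ζ_0 = 0` and transition
`P⁺_{θⁿe}(ζ_n; dy)` at time `n`. -/
def conditionedWalk (𝓛 : Kernel E (Measure ℝ)) : Kernel (ℕ → E) (ℕ → ℝ) :=
  ((envCondChain 𝓛).comap (fun e => (e, (0 : ℝ))) (measurable_id.prodMk measurable_const)).map
    fun h n => (h n).2

instance (𝓛 : Kernel E (Measure ℝ)) : IsMarkovKernel (conditionedWalk 𝓛) := by
  unfold conditionedWalk envCondChain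
  exact Kernel.IsMarkovKernel.map _
    (measurable_pi_lambda _ fun n => measurable_snd.comp (measurable_pi_apply n))

/-! ### Annealed objects -/

variable {Ω : Type*} [MeasurableSpace Ω]

/-- The environment sequence at `ω`; `ξ 0` is the environment of the first step. -/
def env (ξ : ℕ → Ω → E) (ω : Ω) : ℕ → E := fun n => ξ n ω

/-- `U(0) = 𝐄[U(ξ, 0)]`. -/
def meanU (P : Measure Ω) (ξ : ℕ → Ω → E) (𝓛 : Kernel E (Measure ℝ)) : ℝ≥0∞ :=
  ∫⁻ ω, harmonicU 𝓛 (env ξ ω) 0 ∂P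

/-- The law of `(ζ_n)` under the weighted annealed measure
`P̃(·) = ∫ U(ξ, 0) / U(0) · P_ξ(·) d𝐏`. -/
def tiltedAnnealed (P : Measure Ω) (ξ : ℕ → Ω → E) (𝓛 : Kernel E (Measure ℝ)) :
    Measure (ℕ → ℝ) :=
  (P.withDensity fun ω => harmonicU 𝓛 (env ξ ω) 0 / meanU P ξ 𝓛).bind
    fun ω => conditionedWalk 𝓛 (env ξ ω)

/-- `μ^∞ = ∏_n 𝐄(μ_n)`: the law of the steps of the annealed random walk. -/
def annealedSteps (P : Measure Ω) (ξ : ℕ → Ω → E) (𝓛 : Kernel E (Measure ℝ)) :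
    Measure (ℕ → ℝ) :=
  Measure.infinitePi fun n => P.bind fun ω => stepLaw 𝓛 (ξ n ω)

end RWRE

end

/-! ### Splitting an independent sequence at a fixed time -/

noncomputable section

namespace RWRE

/-! Fix an environment `e`. The conditioned walk is an `h`-transform, so U(e,0) times the
expectation of a function of its first n values equals the expectation for the free walk on {S_i ≥ 0
for i ≤ n}, weighted by U(θⁿe, S_n) (`GoodEnv.harmonicU_mul_lintegral_envCondChain`). Let B be an
event that depends on the path up to time k and forces the minimum over times 1, …, k to be attained
at k. Apply this at time k+n to the event "B, and no value below ζ_k during the next n steps", and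
split the free walk at time k. What follows the split contributes E_{θᵏe}[U(θ^{k+n}e, y + S_n); S_i
≥ 0 for i ≤ n] with y = S_k. By optional stopping this is the mean position at time n on staying
nonnegative, plus the part of U(θᵏe, y) carried by paths not yet below 0 at time n. The second term
vanishes as n → ∞ and the first tends to U(θᵏe, 0), so the limit does not depend on y
(`GoodEnv.tendsto_lateExit_add_meanNonneg`). Hence U(e,0) · P_e(ζ ∈ B, ζ stays ≥ ζ_k after k) =
P_e(S ∈ B, S_k ≥ 0) · U(θᵏe, 0) (`GoodEnv.harmonicU_mul_conditionedWalk_eq`).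

The first factor on the right involves only the environment before the split and the second only the
environment after it. In an i.i.d. environment the mean of the product is therefore a probability
for the annealed i.i.d. walk times U(0), and the normalisation of the tilted measure cancels U(0).
The event {ν = k} says that k is a strict minimum over times 1, …, k and that the path never goes
lower afterwards; reversing k i.i.d. steps turns the free-walk event into {Γ₁ = k} and the excursion
into the reversed ladder excursion (`CentredEnv.lintegral_harmonicU_mul_conditionedWalk`). Summing
over k, finiteness of ν follows from finiteness of Γ₁.

Analytic input is needed for U to be finite and positive and for the walk to exit almost surely. For
the annealed walk, reversal and a renewal estimate bound the mean descending ladder height by a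
second moment (`lintegral_negExit_zero_lt_top`), and L¹-bounded martingale convergence gives the
exit (`ae_tau_zero_lt_top`). Fubini transfers both facts to almost every environment
(`CentredEnv.ae_goodEnv`). -/

/-- The first `k` terms of `x`, followed by the sequence `x'`. -/
def splice {α : Type*} (k : ℕ) (x x' : ℕ → α) : ℕ → α := fun i => if i < k then x i else x' (i - k)

lemma measurable_splice {α : Type*} [MeasurableSpace α] (k : ℕ) :
    Measurable fun p : (ℕ → α) × (ℕ → α) => splice k p.1 p.2 := by
  refine measurable_pi_lambda _ fun i => ?_
  unfold splice
  split_ifs <;> fun_prop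

/-- A sequence of independent variables is obtained by splicing two independent ones. -/
lemma map_splice_infinitePi {α : Type*} [MeasurableSpace α] (μ : ℕ → Measure α)
    [∀ n, IsProbabilityMeasure (μ n)] (k : ℕ) :
    ((Measure.infinitePi μ).prod (Measure.infinitePi fun n => μ (n + k))).map
      (fun p => splice k p.1 p.2) = Measure.infinitePi μ := by
  classical
  refine Measure.eq_infinitePi _ fun s t ht => ?_
  rw [Measure.map_apply (measurable_splice k)
    (.pi s.countable_toSet fun i _ => ht i)]
  have hpre : (fun p : (ℕ → α) × (ℕ → α) => splice k p.1 p.2) ⁻¹' (Set.pi s t) =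
      (Set.pi (s.filter (· < k) : Finset ℕ) t) ×ˢ
        (Set.pi ((s.filter (¬ · < k)).image (· - k) : Finset ℕ) fun i => t (i + k)) := by
    ext p
    simp only [Set.mem_preimage, Set.mem_pi, Set.mem_prod, Finset.mem_coe, Finset.mem_filter,
      Finset.mem_image, splice]
    constructor
    · intro h
      refine ⟨fun i hi => by simpa [hi.2] using h i hi.1, ?_⟩
      rintro _ ⟨i, hi, rfl⟩
      have := h i hi.1
      rw [if_neg hi.2] at this
      rwa [Nat.sub_add_cancel (not_lt.1 hi.2)]
    · rintro ⟨h1, h2⟩ i hi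
      split_ifs with hik
      · exact h1 i ⟨hi, hik⟩
      · have := h2 (i - k) ⟨i, ⟨hi, hik⟩, rfl⟩
        rwa [Nat.sub_add_cancel (not_lt.1 hik)] at this
  rw [hpre, Measure.prod_prod, Measure.infinitePi_pi _ fun i _ => ht i,
    Measure.infinitePi_pi _ fun i _ => ht (i + k), Finset.prod_image,
    ← Finset.prod_filter_mul_prod_filter_not s (· < k)]
  · congr 1
    refine Finset.prod_congr rfl fun i hi => ?_
    rw [Nat.sub_add_cancel (not_lt.1 (Finset.mem_filter.1 hi).2)]
  · intro i hi j hj hij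
    have h1 := not_lt.1 (Finset.mem_filter.1 hi).2
    have h2 := not_lt.1 (Finset.mem_filter.1 hj).2
    simp only at hij
    omega

/-- The form in which the Markov property at a fixed time is used throughout: the terms of `x` from
index `k` on are discarded and resampled as `x'`. -/
lemma lintegral_infinitePi_splice {α : Type*} [MeasurableSpace α] (μ : ℕ → Measure α)
    [∀ n, IsProbabilityMeasure (μ n)] (k : ℕ) {f : (ℕ → α) → ℝ≥0∞} (hf : Measurable f) :
    ∫⁻ x, f x ∂(Measure.infinitePi μ) =
      ∫⁻ x, ∫⁻ x', f (splice k x x') ∂(Measure.infinitePi fun n => μ (n + k))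
        ∂(Measure.infinitePi μ) := by
  conv_lhs => rw [← map_splice_infinitePi μ k]
  rw [lintegral_map hf (measurable_splice k), lintegral_prod]
  exact (hf.comp (measurable_splice k)).aemeasurable

lemma lintegral_infinitePi_eval {α : Type*} [MeasurableSpace α] (μ : ℕ → Measure α)
    [∀ n, IsProbabilityMeasure (μ n)] (k : ℕ) {f : α → ℝ≥0∞} (hf : Measurable f) :
    ∫⁻ x, f (x k) ∂(Measure.infinitePi μ) = ∫⁻ a, f a ∂(μ k) := by
  rw [← Measure.infinitePi_map_eval μ k, lintegral_map hf (measurable_pi_apply k)]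

/-! ### Reversal -/

/-- The reversal of the first `k` indices. -/
def rev (k i : ℕ) : ℕ := if i < k then k - 1 - i else i

lemma rev_injective (k : ℕ) : Function.Injective (rev k) := by
  intro i j h
  unfold rev at h
  split_ifs at h <;> omega

lemma map_rev_infinitePi {α : Type*} [MeasurableSpace α] (m : Measure α)
    [IsProbabilityMeasure m] (k : ℕ) :
    (Measure.infinitePi fun _ : ℕ => m).map (fun x i => x (rev k i)) =
      Measure.infinitePi fun _ : ℕ => m :=
  Measure.map_infinitePi_infinitePi_of_inj (P := fun _ : ℕ => m) (rev_injective k)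

lemma lintegral_rev {α : Type*} [MeasurableSpace α] (m : Measure α)
    [IsProbabilityMeasure m] (k : ℕ) {f : (ℕ → α) → ℝ≥0∞} (hf : Measurable f) :
    ∫⁻ x, f x ∂(Measure.infinitePi fun _ : ℕ => m) =
      ∫⁻ x, f (fun i => x (rev k i)) ∂(Measure.infinitePi fun _ : ℕ => m) := by
  conv_lhs => rw [← map_rev_infinitePi m k]
  rw [lintegral_map hf (measurable_pi_lambda _ fun i => measurable_pi_apply _)]

/-! ### Walks of spliced and reversed sequences -/

@[simp] lemma walk_zero (X : ℕ → ℝ) : walk X 0 = 0 := by simp [walk]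

lemma walk_succ (X : ℕ → ℝ) (n : ℕ) : walk X (n + 1) = walk X n + X n := by
  simp [walk, Finset.sum_range_succ]

lemma walk_congr {X Y : ℕ → ℝ} {n : ℕ} (h : ∀ i < n, X i = Y i) : walk X n = walk Y n :=
  Finset.sum_congr rfl fun i hi => h i (Finset.mem_range.1 hi)

lemma walk_splice_of_le {k n : ℕ} (h : n ≤ k) (X X' : ℕ → ℝ) :
    walk (splice k X X') n = walk X n :=
  walk_congr fun i hi => by simp [splice, hi.trans_le h]

lemma walk_splice_add (k n : ℕ) (X X' : ℕ → ℝ) :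
    walk (splice k X X') (k + n) = walk X k + walk X' n := by
  induction n with
  | zero => simp [walk_splice_of_le]
  | succ n ih => rw [← add_assoc, walk_succ, ih, walk_succ]; simp [splice, add_assoc]

lemma walk_rev {k n : ℕ} (h : n ≤ k) (X : ℕ → ℝ) :
    walk (fun i => X (rev k i)) n = walk X k - walk X (k - n) := by
  induction n with
  | zero => simp
  | succ n ih =>
    have h1 : k - n = (k - (n + 1)) + 1 := by omega
    rw [walk_succ, ih (by omega), h1, walk_succ]
    have : rev k n = k - (n + 1) := by unfold rev; split_ifs <;> omega
    rw [this]; ring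

/-- Only the first `k` steps are permuted, so the step that leaves the half-line keeps its place and
its landing point. -/
lemma walk_rev_succ (k : ℕ) (X : ℕ → ℝ) :
    walk (fun i => X (rev k i)) (k + 1) = walk X (k + 1) := by
  rw [walk_succ, walk_rev le_rfl, walk_succ]
  simp [rev]

/-! ### First passage below a level -/

lemma firstTime_eq_top_iff (p : ℕ → Prop) : firstTime p = ⊤ ↔ ∀ n, ¬ p n := by
  simp [firstTime, iInf_eq_top]

lemma tau_eq_top_iff {y : ℝ} {X : ℕ → ℝ} : tau y X = ⊤ ↔ ∀ n, 1 ≤ n → 0 ≤ y + walk X n := by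
  simp [tau, firstTime_eq_top_iff]

lemma tau_eq_coe_iff {y : ℝ} {X : ℕ → ℝ} {n : ℕ} :
    tau y X = n ↔ (1 ≤ n ∧ y + walk X n < 0) ∧ ∀ i, 1 ≤ i → i < n → 0 ≤ y + walk X i := by
  rw [tau, firstTime_eq_coe_iff]
  refine and_congr_right fun _ => forall_congr' fun i => ?_
  simp only [not_and, not_lt]
  tauto

lemma negExit_of_tau_eq {y : ℝ} {X : ℕ → ℝ} {n : ℕ} (h : tau y X = n) :
    negExit y X = ENNReal.ofReal (-(walk X n)) := by
  simp [negExit, h]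

lemma negExit_of_tau_eq_top {y : ℝ} {X : ℕ → ℝ} (h : tau y X = ⊤) : negExit y X = 0 := by
  simp [negExit, h]

lemma exists_tau_eq {y : ℝ} {X : ℕ → ℝ} (h : tau y X < ⊤) : ∃ n : ℕ, tau y X = n :=
  (ENat.ne_top_iff_exists.1 h.ne).imp fun _ h => h.symm

lemma tau_mono {y z : ℝ} (h : y ≤ z) (X : ℕ → ℝ) : tau y X ≤ tau z X := by
  refine le_iInf₂ fun n hn => iInf₂_le n ⟨hn.1, by linarith [hn.2]⟩

/-- If the walk passes below `-y` strictly before `-z`, it is still at least `-z` at that moment,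
hence above its position at the later exit. Without `hz` the claim can fail, since an infinite exit
time gives the value 0. -/
lemma negExit_mono {y z : ℝ} (h : y ≤ z) {X : ℕ → ℝ} (hz : tau z X < ⊤) :
    negExit y X ≤ negExit z X := by
  obtain ⟨n, hn⟩ := exists_tau_eq hz
  obtain ⟨k, hk⟩ := exists_tau_eq ((tau_mono h X).trans_lt hz)
  rw [negExit_of_tau_eq hn, negExit_of_tau_eq hk]
  refine ENNReal.ofReal_le_ofReal (neg_le_neg ?_)
  have hkn : k ≤ n := by
    have := tau_mono h X; rw [hn, hk] at this; exact_mod_cast this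
  rw [tau_eq_coe_iff] at hn hk
  rcases hkn.eq_or_lt with rfl | hlt
  · exact le_rfl
  · have := hn.2 k hk.1.1 hlt
    linarith [hn.1.2]

lemma negExit_pos {y : ℝ} (hy : 0 ≤ y) {X : ℕ → ℝ} (h : tau y X < ⊤) : 0 < negExit y X := by
  obtain ⟨n, hn⟩ := exists_tau_eq h
  rw [negExit_of_tau_eq hn, ENNReal.ofReal_pos]
  linarith [(tau_eq_coe_iff.1 hn).1.2]

lemma tau_splice_eq_top_iff {y : ℝ} {k : ℕ} {X X' : ℕ → ℝ}
    (h : ∀ i, 1 ≤ i → i ≤ k → 0 ≤ y + walk X i) :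
    tau y (splice k X X') = ⊤ ↔ tau (y + walk X k) X' = ⊤ := by
  simp only [tau_eq_top_iff]
  constructor
  · intro h' n hn
    have := h' (k + n) (by omega)
    rwa [walk_splice_add, ← add_assoc] at this
  · intro h' n hn
    rcases le_or_gt n k with hnk | hnk
    · rw [walk_splice_of_le hnk]; exact h n hn hnk
    · obtain ⟨j, rfl⟩ := Nat.exists_eq_add_of_lt hnk
      have := h' (j + 1) (by omega)
      rwa [add_assoc, walk_splice_add, ← add_assoc]

lemma tau_splice {y : ℝ} {k n : ℕ} {X X' : ℕ → ℝ}
    (h : ∀ i, 1 ≤ i → i ≤ k → 0 ≤ y + walk X i) (hn : tau (y + walk X k) X' = n) :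
    tau y (splice k X X') = (k + n : ℕ) := by
  rw [tau_eq_coe_iff] at hn ⊢
  refine ⟨⟨by omega, by rw [walk_splice_add, ← add_assoc]; exact hn.1.2⟩, fun i hi hik => ?_⟩
  rcases le_or_gt i k with h1 | h1
  · rw [walk_splice_of_le h1]; exact h i hi h1
  · obtain ⟨j, rfl⟩ := Nat.exists_eq_add_of_lt h1
    have := hn.2 (j + 1) (by omega) (by omega)
    rwa [add_assoc, walk_splice_add, ← add_assoc]

/-- The Markov decomposition of the exit position. -/
lemma negExit_splice {y : ℝ} (hy : 0 ≤ y) {k : ℕ} {X X' : ℕ → ℝ}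
    (h : ∀ i, 1 ≤ i → i ≤ k → 0 ≤ y + walk X i) (hfin : tau (y + walk X k) X' < ⊤) :
    negExit y (splice k X X') + ENNReal.ofReal (walk X k) =
      negExit (y + walk X k) X' + ENNReal.ofReal (-walk X k) := by
  have hk : 0 ≤ y + walk X k := by
    rcases Nat.eq_zero_or_pos k with rfl | hk
    · simpa using hy
    · exact h k hk le_rfl
  obtain ⟨n, hn⟩ := exists_tau_eq hfin
  rw [negExit_of_tau_eq hn, negExit_of_tau_eq (tau_splice h hn), walk_splice_add]
  have hlt := (tau_eq_coe_iff.1 hn).1.2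
  -- The identity is S_{k+n} = S_k + S'_n, with S_k split into positive and negative parts so that
  -- no subtraction occurs in `ℝ≥0∞`.
  rcases le_total 0 (walk X k) with h0 | h0
  · rw [ENNReal.ofReal_of_nonpos (p := -walk X k) (by linarith), add_zero,
      ← ENNReal.ofReal_add (by linarith) h0]
    congr 1; ring
  · rw [ENNReal.ofReal_of_nonpos h0, add_zero, ← ENNReal.ofReal_add (by linarith) (by linarith)]
    congr 1; ring

end RWRE
end

noncomputable section

namespace RWRE

/-! ### Ladder heights of a random walk with i.i.d. steps -/

lemma exists_pos_measure_Ioi {m : Measure ℝ} (h : 0 < m (Set.Ioi 0)) :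
    ∃ ε : ℝ, 0 < ε ∧ 0 < m (Set.Ioi ε) := by
  by_contra! hcon
  have hU : Set.Ioi (0 : ℝ) = ⋃ n : ℕ, Set.Ioi (1 / ((n : ℝ) + 1)) := by
    ext x
    simp only [Set.mem_Ioi, Set.mem_iUnion]
    exact ⟨fun hx => exists_nat_one_div_lt hx, fun ⟨n, hn⟩ => lt_trans (by positivity) hn⟩
  rw [hU] at h
  refine h.ne' (measure_iUnion_null fun n => ?_)
  exact le_antisymm (hcon _ (by positivity)) bot_le

/-- An event that depends on the first `n` variables is independent of the next one. -/
lemma lintegral_indicator_mul_eval {α : Type*} [MeasurableSpace α] (μ : ℕ → Measure α)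
    [∀ n, IsProbabilityMeasure (μ n)] {n : ℕ} {A : Set (ℕ → α)} (hA : MeasurableSet A)
    (hdep : ∀ x x', splice n x x' ∈ A ↔ x ∈ A) {g : α → ℝ≥0∞} (hg : Measurable g) :
    ∫⁻ x, A.indicator 1 x * g (x n) ∂(Measure.infinitePi μ) =
      Measure.infinitePi μ A * ∫⁻ a, g a ∂(μ n) := by
  have hm : Measurable fun x : ℕ → α => A.indicator (1 : (ℕ → α) → ℝ≥0∞) x * g (x n) :=
    (measurable_one.indicator hA).mul (hg.comp (measurable_pi_apply n))
  rw [lintegral_infinitePi_splice μ n hm]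
  have h1 : ∀ x x' : ℕ → α, A.indicator (1 : (ℕ → α) → ℝ≥0∞) (splice n x x') * g (splice n x x' n)
      = A.indicator 1 x * g (x' 0) := by
    intro x x'
    have h2 : splice n x x' n = x' 0 := by simp [splice]
    rw [h2]
    by_cases hx : x ∈ A
    · simp [hx, (hdep x x').2 hx]
    · simp [hx, mt (hdep x x').1 hx]
  simp only [h1]
  have h3 : ∀ x : ℕ → α, ∫⁻ x' : ℕ → α, A.indicator (1 : (ℕ → α) → ℝ≥0∞) x * g (x' 0)
      ∂(Measure.infinitePi fun i => μ (i + n)) = A.indicator 1 x * ∫⁻ a, g a ∂(μ n) := by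
    intro x
    have hg0 : Measurable fun x' : ℕ → α => g (x' 0) := hg.comp (measurable_pi_apply 0)
    rw [lintegral_const_mul _ hg0,
      lintegral_infinitePi_eval (fun i => μ (i + n)) 0 hg, zero_add]
  simp only [h3]
  rw [lintegral_mul_const _ (measurable_one.indicator hA), lintegral_indicator_one hA]

/-- `n` is a weak ascending record of the walk, with value in `[a, b)`. -/
def recordIn (a b : ℝ) (n : ℕ) : Set (ℕ → ℝ) :=
  {X | (∀ i ≤ n, walk X i ≤ walk X n) ∧ a ≤ walk X n ∧ walk X n < b}

lemma measurableSet_recordIn (a b : ℝ) (n : ℕ) : MeasurableSet (recordIn a b n) := by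
  have := measurable_walk
  unfold recordIn
  measurability

lemma splice_mem_recordIn {a b : ℝ} {n : ℕ} (X X' : ℕ → ℝ) :
    splice n X X' ∈ recordIn a b n ↔ X ∈ recordIn a b n := by
  simp only [recordIn, Set.mem_ofPred_eq, walk_splice_of_le le_rfl]
  refine and_congr_left fun _ => forall₂_congr fun i hi => ?_
  rw [walk_splice_of_le hi]

lemma measure_Iio_pos_of_integral_eq_zero {m : Measure ℝ} (hint : Integrable id m) (hmean : ∫ x, x ∂m = 0)
    (hpos : 0 < m (Set.Ioi 0)) : 0 < m (Set.Iio 0) := by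
  by_contra! h
  have h0 : ∀ᵐ x ∂m, 0 ≤ x := by
    rw [ae_iff]
    simp only [not_le]
    exact le_antisymm h bot_le
  have h1 := (integral_eq_zero_iff_of_nonneg_ae (f := id) h0 hint).1 hmean
  refine hpos.ne' (measure_mono_null (fun x hx => ?_) (ae_iff.1 h1))
  exact ne_of_gt hx

variable (m : Measure ℝ) [IsProbabilityMeasure m]

/-- The renewal measure of the weak ascending ladder heights is bounded on short intervals. -/
lemma tsum_measure_recordIn_mul_le {ε : ℝ} (a : ℝ) :
    (∑' n, Measure.infinitePi (fun _ : ℕ => m) (recordIn a (a + ε) n)) * m (Set.Ioi ε) ≤ 1 := by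
  rw [← ENNReal.tsum_mul_right]
  have hmeas : ∀ n, MeasurableSet (recordIn a (a + ε) n ∩ {X | ε < X n}) := fun n =>
    (measurableSet_recordIn _ _ n).inter (measurableSet_lt measurable_const (measurable_pi_apply n))
  have h1 : ∀ n, Measure.infinitePi (fun _ : ℕ => m) (recordIn a (a + ε) n) * m (Set.Ioi ε) =
      Measure.infinitePi (fun _ : ℕ => m) (recordIn a (a + ε) n ∩ {X | ε < X n}) := by
    intro n
    rw [← lintegral_indicator_one (hmeas n), ← lintegral_indicator_one measurableSet_Ioi,
      ← lintegral_indicator_mul_eval (fun _ : ℕ => m) (measurableSet_recordIn _ _ n)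
        splice_mem_recordIn (measurable_one.indicator measurableSet_Ioi)]
    refine lintegral_congr fun X => ?_
    rw [Set.inter_indicator_one]
    rfl
  simp only [h1]
  -- A record in `[a, a + ε)` followed by a step larger than `ε` carries the walk beyond `a + ε`, so
  -- no later record can lie in this interval.
  have hdisj : Pairwise
      (Function.onFun Disjoint fun n => recordIn a (a + ε) n ∩ {X : ℕ → ℝ | ε < X n}) := by
    have key : ∀ n k, n < k → Disjoint (recordIn a (a + ε) n ∩ {X : ℕ → ℝ | ε < X n})
        (recordIn a (a + ε) k ∩ {X : ℕ → ℝ | ε < X k}) := by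
      intro n k hnk
      rw [Set.disjoint_left]
      rintro X ⟨⟨-, h2, -⟩, h3⟩ ⟨⟨h4, -, h5⟩, -⟩
      have := h4 (n + 1) hnk
      rw [walk_succ] at this
      have h3' : ε < X n := h3
      linarith
    intro n k hnk
    rcases hnk.lt_or_gt with h | h
    · exact key n k h
    · exact (key k n h).symm
  rw [← measure_iUnion hdisj hmeas]
  exact prob_le_one

/-- Only the term with `n + 1` equal to the exit time is needed. -/
lemma negExit_zero_le_tsum (X : ℕ → ℝ) :
    negExit 0 X ≤ ∑' n, {X : ℕ → ℝ | ∀ i ≤ n, 0 ≤ walk X i}.indicator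
      (fun X => ENNReal.ofReal (-walk X (n + 1))) X := by
  rcases eq_or_ne (tau 0 X) ⊤ with h | h
  · rw [negExit_of_tau_eq_top h]; exact bot_le
  · obtain ⟨k, hk⟩ := exists_tau_eq h.lt_top
    rw [negExit_of_tau_eq hk]
    obtain ⟨⟨h1, -⟩, h2⟩ := tau_eq_coe_iff.1 hk
    obtain ⟨n, rfl⟩ := Nat.exists_eq_add_of_le' h1
    refine le_trans ?_ (ENNReal.le_tsum n)
    rw [Set.indicator_of_mem]
    intro i hi
    rcases Nat.eq_zero_or_pos i with rfl | h0
    · simp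
    · simpa using h2 i h0 (by omega)

/-- With `j` the index of the cell of length `ε` containing S_n, one has -S_{n+1} = -S_n - X_n ≤
-X_n - jε. This separates the record position from the next step, which are independent. -/
lemma ofReal_record_le_tsum {ε : ℝ} (hε : 0 < ε) (n : ℕ) (X : ℕ → ℝ) :
    {X : ℕ → ℝ | ∀ i ≤ n, walk X i ≤ walk X n}.indicator
      (fun X => ENNReal.ofReal (-walk X (n + 1))) X ≤
    ∑' j : ℕ, (recordIn (j * ε) (j * ε + ε) n).indicator 1 X *
      ENNReal.ofReal (-X n - j * ε) := by
  by_cases h : ∀ i ≤ n, walk X i ≤ walk X n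
  · rw [Set.indicator_of_mem (by exact h)]
    have h0 : 0 ≤ walk X n := by simpa using h 0 (Nat.zero_le n)
    set j := ⌊walk X n / ε⌋₊ with hj
    have h1 : (j : ℝ) * ε ≤ walk X n := by
      rw [← le_div_iff₀ hε]; exact Nat.floor_le (by positivity)
    have h2 : walk X n < j * ε + ε := by
      have := Nat.lt_floor_add_one (walk X n / ε)
      rw [div_lt_iff₀ hε] at this
      linarith
    refine le_trans ?_ (ENNReal.le_tsum j)
    rw [Set.indicator_of_mem (by exact ⟨h, h1, h2⟩), Pi.one_apply, one_mul, walk_succ]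
    exact ENNReal.ofReal_le_ofReal (by linarith)
  · rw [Set.indicator_of_notMem (by exact h)]; exact bot_le

/-- About |x|/ε terms are nonzero and each is at most |x|: this is where a second moment of the step
is spent to get a first moment of the ladder height. -/
lemma tsum_ofReal_sub_le {ε : ℝ} (hε : 0 < ε) (x : ℝ) :
    ∑' j : ℕ, ENNReal.ofReal (-x - j * ε) ≤
      ENNReal.ofReal (1 / ε + 2) * (1 + ENNReal.ofReal (x ^ 2)) := by
  rw [tsum_eq_sum (s := Finset.range ⌈|x| / ε⌉₊)]
  · calc ∑ j ∈ Finset.range ⌈|x| / ε⌉₊, ENNReal.ofReal (-x - j * ε)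
        ≤ ∑ j ∈ Finset.range ⌈|x| / ε⌉₊, ENNReal.ofReal |x| := by
          refine Finset.sum_le_sum fun j _ => ENNReal.ofReal_le_ofReal ?_
          have : 0 ≤ (j : ℝ) * ε := by positivity
          linarith [neg_le_abs x]
      _ = ENNReal.ofReal (⌈|x| / ε⌉₊ * |x|) := by
          rw [Finset.sum_const, Finset.card_range, nsmul_eq_mul,
            ENNReal.ofReal_mul (Nat.cast_nonneg _), ENNReal.ofReal_natCast]
      _ ≤ ENNReal.ofReal ((1 / ε + 2) * (1 + x ^ 2)) := by
          refine ENNReal.ofReal_le_ofReal ?_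
          have h1 : (⌈|x| / ε⌉₊ : ℝ) ≤ |x| / ε + 1 := (Nat.ceil_lt_add_one (by positivity)).le
          calc (⌈|x| / ε⌉₊ : ℝ) * |x| ≤ (|x| / ε + 1) * |x| := by gcongr
            _ = 1 / ε * |x| ^ 2 + |x| := by ring
            _ ≤ 1 / ε * (1 + x ^ 2) + 2 * (1 + x ^ 2) := by
              rw [sq_abs]
              gcongr
              · linarith
              · nlinarith [sq_abs x, sq_nonneg (|x| - 1)]
            _ = _ := by ring
      _ = _ := by
          rw [ENNReal.ofReal_mul (by positivity), ENNReal.ofReal_add zero_le_one (sq_nonneg x),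
            ENNReal.ofReal_one]
  · intro j hj
    rw [Finset.mem_range, not_lt, Nat.ceil_le, div_le_iff₀ hε] at hj
    exact ENNReal.ofReal_of_nonpos (by linarith [neg_le_abs x])

/-- The first strict descending ladder height of a walk whose steps have a finite second moment
is integrable. -/
lemma lintegral_negExit_zero_lt_top (hsq : ∫⁻ x, ENNReal.ofReal (x ^ 2) ∂m < ∞)
    (hpos : 0 < m (Set.Ioi 0)) :
    ∫⁻ X, negExit 0 X ∂(Measure.infinitePi fun _ : ℕ => m) < ∞ := by
  obtain ⟨ε, hε, hp⟩ := exists_pos_measure_Ioi hpos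
  have hw := measurable_walk
  have hms : ∀ n, MeasurableSet {X : ℕ → ℝ | ∀ i ≤ n, 0 ≤ walk X i} := fun n => by measurability
  have hφ : ∀ j : ℕ, Measurable fun x : ℝ => ENNReal.ofReal (-x - j * ε) := fun j => by fun_prop
  have hind : ∀ (j : ℕ) n, Measurable ((recordIn (j * ε) (j * ε + ε) n).indicator
      (1 : (ℕ → ℝ) → ℝ≥0∞)) := fun j n =>
    measurable_one.indicator (measurableSet_recordIn _ _ n)
  have hterm : ∀ n (j : ℕ), Measurable fun X : ℕ → ℝ =>
      (recordIn (j * ε) (j * ε + ε) n).indicator (1 : (ℕ → ℝ) → ℝ≥0∞) X *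
        ENNReal.ofReal (-X n - j * ε) := fun n j =>
    (hind j n).mul ((hφ j).comp (measurable_pi_apply n))
  -- Duality: reversing the first `n` steps turns "nonnegative up to time `n`" into "time `n` is a
  -- weak record" and leaves S_{n+1} unchanged.
  have hrev : ∀ n, ∫⁻ X, {X : ℕ → ℝ | ∀ i ≤ n, 0 ≤ walk X i}.indicator
      (fun X => ENNReal.ofReal (-walk X (n + 1))) X ∂(Measure.infinitePi fun _ : ℕ => m) =
      ∫⁻ X, {X : ℕ → ℝ | ∀ i ≤ n, walk X i ≤ walk X n}.indicator
        (fun X => ENNReal.ofReal (-walk X (n + 1))) X ∂(Measure.infinitePi fun _ : ℕ => m) := by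
    intro n
    rw [lintegral_rev m n]
    · refine lintegral_congr fun X => ?_
      simp only [Set.indicator, Set.mem_ofPred_eq, walk_rev_succ]
      have : (∀ i ≤ n, 0 ≤ walk (fun i => X (rev n i)) i) ↔ ∀ i ≤ n, walk X i ≤ walk X n := by
        constructor
        · intro h i hi
          have := h (n - i) (by omega)
          rw [walk_rev (by omega), Nat.sub_sub_self hi] at this
          linarith
        · intro h i hi
          rw [walk_rev hi]
          linarith [h (n - i) (by omega)]
      simp only [this]
    · exact Measurable.indicator (by fun_prop) (hms n)
  calc ∫⁻ X, negExit 0 X ∂(Measure.infinitePi fun _ : ℕ => m)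
      ≤ ∫⁻ X, ∑' n, {X : ℕ → ℝ | ∀ i ≤ n, 0 ≤ walk X i}.indicator
          (fun X => ENNReal.ofReal (-walk X (n + 1))) X ∂(Measure.infinitePi fun _ : ℕ => m) :=
        lintegral_mono negExit_zero_le_tsum
    _ = ∑' n, ∫⁻ X, {X : ℕ → ℝ | ∀ i ≤ n, walk X i ≤ walk X n}.indicator
          (fun X => ENNReal.ofReal (-walk X (n + 1))) X ∂(Measure.infinitePi fun _ : ℕ => m) := by
        rw [lintegral_tsum fun n => (Measurable.indicator (by fun_prop) (hms n)).aemeasurable]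
        simp only [hrev]
    _ ≤ ∑' n, ∑' j : ℕ, ∫⁻ X, (recordIn (j * ε) (j * ε + ε) n).indicator 1 X *
          ENNReal.ofReal (-X n - j * ε) ∂(Measure.infinitePi fun _ : ℕ => m) := by
        refine ENNReal.tsum_le_tsum fun n => ?_
        rw [← lintegral_tsum fun j => (hterm n j).aemeasurable]
        exact lintegral_mono (ofReal_record_le_tsum hε n)
    _ = ∑' j : ℕ, (∑' n, Measure.infinitePi (fun _ : ℕ => m) (recordIn (j * ε) (j * ε + ε) n)) *
          ∫⁻ x, ENNReal.ofReal (-x - j * ε) ∂m := by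
        rw [ENNReal.tsum_comm]
        refine tsum_congr fun j => ?_
        rw [← ENNReal.tsum_mul_right]
        exact tsum_congr fun n => lintegral_indicator_mul_eval (fun _ : ℕ => m)
          (measurableSet_recordIn _ _ n) splice_mem_recordIn (hφ j)
    _ ≤ ∑' j : ℕ, (m (Set.Ioi ε))⁻¹ * ∫⁻ x, ENNReal.ofReal (-x - j * ε) ∂m := by
        -- The expected number of records in each cell is at most 1 / m(ε, ∞), uniformly in `j`.
        gcongr with j
        rw [ENNReal.le_inv_iff_mul_le]
        exact tsum_measure_recordIn_mul_le m _
    _ = (m (Set.Ioi ε))⁻¹ * ∫⁻ x, ∑' j : ℕ, ENNReal.ofReal (-x - j * ε) ∂m := by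
        rw [ENNReal.tsum_mul_left, lintegral_tsum fun j => (hφ j).aemeasurable]
    _ ≤ (m (Set.Ioi ε))⁻¹ *
          ∫⁻ x, ENNReal.ofReal (1 / ε + 2) * (1 + ENNReal.ofReal (x ^ 2)) ∂m := by
        gcongr with x
        exact tsum_ofReal_sub_le hε x
    _ < ∞ := by
        rw [lintegral_const_mul _ (by fun_prop), lintegral_add_left measurable_const,
          lintegral_const, measure_univ]
        refine ENNReal.mul_lt_top (ENNReal.inv_lt_top.2 hp)
          (ENNReal.mul_lt_top ENNReal.ofReal_lt_top ?_)
        simpa using hsq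

/-! ### Recurrence -/

lemma measurable_negExit_right (y : ℝ) : Measurable fun X : ℕ → ℝ => negExit y X := by
  have h := measurable_negExit.comp
    ((measurable_const (a := y)).prodMk (measurable_id (α := ℕ → ℝ)))
  simpa only [Function.comp_def, id_eq] using h

/-- The walk stopped when it becomes negative, at time `n + 1`. -/
def stoppedWalk (n : ℕ) (X : ℕ → ℝ) : ℝ :=
  ∑ i ∈ Finset.range (n + 1), {X : ℕ → ℝ | ∀ j ≤ i, 0 ≤ walk X j}.indicator (fun X => X i) X

lemma stoppedWalk_of_nonneg {n : ℕ} {X : ℕ → ℝ} (h : ∀ j ≤ n, 0 ≤ walk X j) :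
    stoppedWalk n X = walk X (n + 1) := by
  refine Finset.sum_congr rfl fun i hi => ?_
  rw [Set.indicator_of_mem]
  exact fun j hj => h j (hj.trans (Nat.lt_succ_iff.1 (Finset.mem_range.1 hi)))

/-- Until the exit the stopped walk is nonnegative; from then on it is frozen at the exit position,
which is minus `negExit`. The bound is thus uniform in time. -/
lemma neg_negExit_le_stoppedWalk (n : ℕ) (X : ℕ → ℝ) :
    -(negExit 0 X).toReal ≤ stoppedWalk n X := by
  induction n with
  | zero =>
    rw [stoppedWalk_of_nonneg (by simp)]
    rcases le_or_gt 0 (walk X (0 + 1)) with h | h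
    · linarith [ENNReal.toReal_nonneg (a := negExit 0 X)]
    · have : tau 0 X = (1 : ℕ) := tau_eq_coe_iff.2 ⟨⟨le_rfl, by simpa using h⟩, by omega⟩
      rw [negExit_of_tau_eq this, ENNReal.toReal_ofReal (by simpa using h.le)]
      simp
  | succ n ih =>
    by_cases hg : ∀ j ≤ n + 1, 0 ≤ walk X j
    · rw [stoppedWalk_of_nonneg hg]
      rcases le_or_gt 0 (walk X (n + 1 + 1)) with h | h
      · linarith [ENNReal.toReal_nonneg (a := negExit 0 X)]
      · have : tau 0 X = (n + 1 + 1 : ℕ) := tau_eq_coe_iff.2 ⟨⟨by omega, by simpa using h⟩,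
          fun i _ hi => by simpa using hg i (by omega)⟩
        rw [negExit_of_tau_eq this, ENNReal.toReal_ofReal (by linarith)]
        simp
    -- The walk has already been negative, so the new increment is zero and the induction hypothesis
    -- applies.
    · rw [stoppedWalk, Finset.sum_range_succ, Set.indicator_of_notMem (by exact hg), add_zero]
      exact ih

/-- The second Borel–Cantelli lemma. -/
lemma ae_frequently_lt_eval {ε : ℝ} (hp : 0 < m (Set.Ioi ε)) :
    ∀ᵐ X ∂(Measure.infinitePi fun _ : ℕ => m), ∃ᶠ n in Filter.atTop, ε < X n := by
  have hind : iIndepFun (fun (n : ℕ) (X : ℕ → ℝ) => X n) (Measure.infinitePi fun _ : ℕ => m) :=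
    iIndepFun_infinitePi (X := fun _ x => x) fun _ => measurable_id
  have hsm : ∀ n : ℕ, MeasurableSet {X : ℕ → ℝ | ε < X n} := fun n =>
    measurableSet_lt measurable_const (measurable_pi_apply n)
  have hs : iIndepSet (fun n : ℕ => {X : ℕ → ℝ | ε < X n}) (Measure.infinitePi fun _ : ℕ => m) := by
    rw [iIndepSet_iff_meas_biInter hsm]
    intro s
    exact hind.measure_inter_preimage_eq_mul s (sets := fun _ => Set.Ioi ε)
      fun _ _ => measurableSet_Ioi
  have hmeas : ∀ n : ℕ, Measure.infinitePi (fun _ : ℕ => m) {X : ℕ → ℝ | ε < X n} =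
      m (Set.Ioi ε) := by
    intro n
    rw [← Measure.infinitePi_map_eval (fun _ : ℕ => m) n,
      Measure.map_apply (measurable_pi_apply n) measurableSet_Ioi,
      Measure.infinitePi_map_eval (fun _ : ℕ => m) n]
    rfl
  have h1 := measure_limsup_eq_one hsm hs (by
    simp only [hmeas]; exact ENNReal.tsum_const_eq_top_of_ne_zero hp.ne')
  rw [← mem_ae_iff_prob_eq_one (MeasurableSet.measurableSet_limsup hsm)] at h1
  filter_upwards [h1] with X hX
  exact Filter.mem_limsup_iff_frequently_mem.1 hX

lemma integral_infinitePi_eval (i : ℕ) :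
    ∫ X : ℕ → ℝ, X i ∂(Measure.infinitePi fun _ : ℕ => m) = ∫ x, x ∂m := by
  have h := integral_map (μ := Measure.infinitePi fun _ : ℕ => m) (φ := fun X : ℕ → ℝ => X i)
    (f := fun x : ℝ => x) (measurable_pi_apply i).aemeasurable (by fun_prop)
  rw [← h, Measure.infinitePi_map_eval (fun _ : ℕ => m) i]

/-- Each increment is a centred step multiplied by the indicator of an event determined by the
earlier steps. -/
lemma martingale_stoppedWalk (hint : Integrable id m) (hmean : ∫ x, x ∂m = 0) :
    Martingale stoppedWalk
      (Filtration.natural (fun (n : ℕ) (X : ℕ → ℝ) => X n) fun i =>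
        (measurable_pi_apply i).stronglyMeasurable) (Measure.infinitePi fun _ : ℕ => m) := by
  set π := Measure.infinitePi fun _ : ℕ => m with hπ
  have hsm : ∀ i : ℕ, StronglyMeasurable fun X : ℕ → ℝ => X i := fun i =>
    (measurable_pi_apply i).stronglyMeasurable
  have hind : iIndepFun (fun (n : ℕ) (X : ℕ → ℝ) => X n) π :=
    iIndepFun_infinitePi (X := fun _ x => x) fun _ => measurable_id
  set 𝓕 := Filtration.natural (fun (n : ℕ) (X : ℕ → ℝ) => X n) hsm with h𝓕
  have hX𝓕 : ∀ i n : ℕ, i ≤ n → Measurable[𝓕 n] fun X : ℕ → ℝ => X i := fun i n hin =>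
    ((Filtration.stronglyAdapted_natural hsm i).mono (𝓕.mono hin)).measurable
  -- Steps are indexed from 0: `𝓕 n` is generated by `n + 1` steps, hence determines the walk up to
  -- time `n + 1`.
  have hw𝓕 : ∀ i n : ℕ, i ≤ n + 1 → Measurable[𝓕 n] fun X : ℕ → ℝ => walk X i := fun i n hin =>
    Finset.measurable_fun_sum _ fun j hj => hX𝓕 j n (by have := Finset.mem_range.1 hj; omega)
  have hset : ∀ n i : ℕ, i ≤ n + 1 → MeasurableSet[𝓕 n] {X : ℕ → ℝ | ∀ j ≤ i, 0 ≤ walk X j} := by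
    intro n i hin
    have : {X : ℕ → ℝ | ∀ j ≤ i, 0 ≤ walk X j} = ⋂ (j : ℕ) (_ : j ≤ i), {X | 0 ≤ walk X j} := by
      ext; simp
    rw [this]
    refine MeasurableSet.iInter fun j => MeasurableSet.iInter fun hj => ?_
    exact @measurableSet_le _ _ _ _ _ (𝓕 n) _ _ _ _ _ (@measurable_const _ _ _ (𝓕 n) 0)
      (hw𝓕 j n (by omega))
  have hXint : ∀ i : ℕ, Integrable (fun X : ℕ → ℝ => X i) π := fun i =>
    (measurePreserving_eval_infinitePi (fun _ : ℕ => m) i).integrable_comp_of_integrable hint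
  have hXmean : ∀ i : ℕ, ∫ X : ℕ → ℝ, X i ∂π = 0 := fun i =>
    (integral_infinitePi_eval m i).trans hmean
  have hSint : ∀ n, Integrable (stoppedWalk n) π := by
    intro n
    unfold stoppedWalk
    refine integrable_finsetSum _ fun i _ => (hXint i).indicator ?_
    exact 𝓕.le i _ (hset i i (by omega))
  refine martingale_of_condExp_sub_eq_zero_nat (fun n => ?_) hSint fun n => ?_
  · refine (Measurable.stronglyMeasurable ?_)
    unfold stoppedWalk
    refine Finset.measurable_fun_sum _ fun i hi => ?_
    have hi' : i ≤ n := by have := Finset.mem_range.1 hi; omega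
    exact Measurable.indicator (hX𝓕 i n hi') (hset n i (by omega))
  · have h1 : stoppedWalk (n + 1) - stoppedWalk n =
        {X : ℕ → ℝ | ∀ j ≤ n + 1, 0 ≤ walk X j}.indicator (fun X => X (n + 1)) := by
      ext X
      rw [Pi.sub_apply, stoppedWalk, Finset.sum_range_succ, stoppedWalk, add_sub_cancel_left]
    rw [h1]
    refine (condExp_indicator (hXint (n + 1)) (hset n (n + 1) le_rfl)).trans ?_
    have h2 : π[fun X : ℕ → ℝ => X (n + 1) | 𝓕 n] =ᵐ[π] fun _ => ∫ X : ℕ → ℝ, X (n + 1) ∂π :=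
      hind.condExp_natural_ae_eq_of_lt hsm (Nat.lt_succ_self n)
    filter_upwards [h2] with X hX
    rw [Set.indicator_apply, hX, hXmean, ite_self, Pi.zero_apply]

/-- If the walk never exits, it coincides with the stopped walk and converges, so its steps tend to
0; this contradicts infinitely many steps above `ε`. -/
lemma tau_lt_top_of_tendsto_stoppedWalk {ε c : ℝ} (hε : 0 < ε) {X : ℕ → ℝ}
    (hfreq : ∃ᶠ n in Filter.atTop, ε < X n)
    (hc : Filter.Tendsto (fun n => stoppedWalk n X) Filter.atTop (nhds c)) : tau 0 X < ⊤ := by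
  rw [lt_top_iff_ne_top]
  intro htop
  rw [tau_eq_top_iff] at htop
  have hgood : ∀ n, ∀ j ≤ n, 0 ≤ walk X j := by
    intro n j _
    rcases Nat.eq_zero_or_pos j with rfl | hj
    · simp
    · simpa using htop j hj
  simp only [fun n => stoppedWalk_of_nonneg (hgood n)] at hc
  have hd : Filter.Tendsto (fun n => walk X (n + 1 + 1) - walk X (n + 1)) Filter.atTop
      (nhds (c - c)) := ((Filter.tendsto_add_atTop_iff_nat 1).2 hc).sub hc
  rw [sub_self] at hd
  have hX0 : Filter.Tendsto X Filter.atTop (nhds 0) := by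
    rw [← Filter.tendsto_add_atTop_iff_nat 1]
    refine hd.congr fun n => ?_
    rw [walk_succ X (n + 1)]; ring
  obtain ⟨n, h1, h2⟩ := (hfreq.and_eventually (hX0.eventually (gt_mem_nhds hε))).exists
  exact lt_asymm h1 h2

lemma integral_stoppedWalk (hint : Integrable id m) (hmean : ∫ x, x ∂m = 0) (n : ℕ) :
    ∫ X, stoppedWalk n X ∂(Measure.infinitePi fun _ : ℕ => m) = 0 := by
  have hmart := martingale_stoppedWalk m hint hmean
  have h1 := hmart.setIntegral_eq (Nat.zero_le n) MeasurableSet.univ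
  rw [setIntegral_univ, setIntegral_univ] at h1
  have h0 : ∀ X, stoppedWalk 0 X = X 0 := fun X => by simp [stoppedWalk_of_nonneg, walk_succ]
  rw [← h1, integral_congr_ae (Filter.Eventually.of_forall h0)]
  exact (integral_infinitePi_eval m 0).trans hmean

/-- Since M ≥ -N with N ≥ 0, one has |M| ≤ M + 2N, and M has mean zero. -/
lemma integral_norm_stoppedWalk_le (hint : Integrable id m) (hmean : ∫ x, x ∂m = 0)
    (hneg : ∫⁻ X, negExit 0 X ∂(Measure.infinitePi fun _ : ℕ => m) < ∞) (n : ℕ) :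
    ∫ X, ‖stoppedWalk n X‖ ∂(Measure.infinitePi fun _ : ℕ => m) ≤
      2 * ∫ X, (negExit 0 X).toReal ∂(Measure.infinitePi fun _ : ℕ => m) := by
  have hSint := (martingale_stoppedWalk m hint hmean).integrable n
  have hnint := (integrable_toReal_of_lintegral_ne_top
    (measurable_negExit_right 0).aemeasurable hneg.ne).const_mul 2
  have h1 := integral_mono hSint.norm (hSint.add hnint) fun X => by
    have h1 := neg_negExit_le_stoppedWalk n X
    have h2 := ENNReal.toReal_nonneg (a := negExit 0 X)
    simp only [Real.norm_eq_abs, Pi.add_apply]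
    exact abs_le.2 ⟨by linarith, by linarith⟩
  rwa [integral_add' hSint hnint, integral_stoppedWalk m hint hmean, zero_add,
    integral_const_mul] at h1

lemma ae_tau_zero_lt_top (hint : Integrable id m) (hmean : ∫ x, x ∂m = 0)
    (hneg : ∫⁻ X, negExit 0 X ∂(Measure.infinitePi fun _ : ℕ => m) < ∞)
    (hpos : 0 < m (Set.Ioi 0)) :
    ∀ᵐ X ∂(Measure.infinitePi fun _ : ℕ => m), tau 0 X < ⊤ := by
  obtain ⟨ε, hε, hp⟩ := exists_pos_measure_Ioi hpos
  have hmart := martingale_stoppedWalk m hint hmean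
  have hbdd : ∀ n, eLpNorm (stoppedWalk n) 1 (Measure.infinitePi fun _ : ℕ => m) ≤
      (Real.toNNReal (2 * ∫ X, (negExit 0 X).toReal ∂(Measure.infinitePi fun _ : ℕ => m)) :
        ℝ≥0∞) := by
    intro n
    rw [eLpNorm_one_eq_lintegral_enorm,
      ← ofReal_integral_norm_eq_lintegral_enorm (hmart.integrable n)]
    exact ENNReal.ofReal_le_ofReal (integral_norm_stoppedWalk_le m hint hmean hneg n)
  filter_upwards [hmart.submartingale.exists_ae_tendsto_of_bdd hbdd,
    ae_frequently_lt_eval m hp] with X ⟨c, hc⟩ hfreq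
  exact tau_lt_top_of_tendsto_stoppedWalk hε hfreq hc

/-- Keep only the paths whose first step exceeds `ε`. It is used to pass from the starting level kε
to (k+1)ε, for the finiteness of the exit time and of the mean exit position alike. -/
lemma measure_Ioi_mul_lintegral_le {ε : ℝ} {f g : (ℕ → ℝ) → ℝ≥0∞} (hf : Measurable f)
    (h : ∀ X : ℕ → ℝ, ε < X 0 → ∀ᵐ X' ∂(Measure.infinitePi fun _ : ℕ => m),
      g X' ≤ f (splice 1 X X')) :
    m (Set.Ioi ε) * ∫⁻ X, g X ∂(Measure.infinitePi fun _ : ℕ => m) ≤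
      ∫⁻ X, f X ∂(Measure.infinitePi fun _ : ℕ => m) := by
  rw [lintegral_infinitePi_splice (fun _ : ℕ => m) 1 hf, ← lintegral_indicator_one
    measurableSet_Ioi, ← lintegral_infinitePi_eval (fun _ : ℕ => m) 0
      (measurable_one.indicator measurableSet_Ioi), ← lintegral_mul_const]
  · refine lintegral_mono fun X => ?_
    by_cases hX : X 0 ∈ Set.Ioi ε
    · rw [Set.indicator_of_mem hX, Pi.one_apply, one_mul]
      exact lintegral_mono_ae (h X hX)
    · simp [Set.indicator_of_notMem hX]
  · exact (measurable_one.indicator measurableSet_Ioi).comp (measurable_pi_apply 0)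

/-- A walk from kε reaches at least (k+1)ε in one step with positive probability. If survival from
the higher level had positive probability, so would survival from the lower one. -/
lemma ae_tau_nat_lt_top {ε : ℝ} (hε : 0 < ε) (hp : 0 < m (Set.Ioi ε))
    (h0 : ∀ᵐ X ∂(Measure.infinitePi fun _ : ℕ => m), tau 0 X < ⊤) (k : ℕ) :
    ∀ᵐ X ∂(Measure.infinitePi fun _ : ℕ => m), tau (k * ε) X < ⊤ := by
  have hms : ∀ y : ℝ, MeasurableSet {X : ℕ → ℝ | tau y X = ⊤} := fun y =>
    (measurable_tau.comp (measurable_const.prodMk measurable_id)) (measurableSet_singleton ⊤)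
  induction k with
  | zero => simpa using h0
  | succ k ih =>
    have h1 := measure_Ioi_mul_lintegral_le m (ε := ε)
      (f := {X : ℕ → ℝ | tau (k * ε) X = ⊤}.indicator 1)
      (g := {X : ℕ → ℝ | tau ((k + 1 : ℕ) * ε) X = ⊤}.indicator 1)
      (measurable_one.indicator (hms _)) (by
        intro X hX
        refine Filter.Eventually.of_forall fun X' => ?_
        by_cases hX' : tau ((k + 1 : ℕ) * ε) X' = ⊤
        · rw [Set.indicator_of_mem (by exact hX'), Set.indicator_of_mem]
          · simp
          have hw : walk X 1 = X 0 := by simp [walk]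
          have hk : 0 ≤ (k : ℝ) * ε := by positivity
          refine (tau_splice_eq_top_iff fun i hi hi1 => ?_).2 ?_
          · obtain rfl : i = 1 := le_antisymm hi1 hi
            rw [hw]; linarith
          · rw [hw]
            refine top_le_iff.1 (hX'.symm.trans_le (tau_mono ?_ X'))
            push_cast; linarith
        · rw [Set.indicator_of_notMem (by exact hX')]; exact bot_le)
    rw [lintegral_indicator_one (hms _), lintegral_indicator_one (hms _)] at h1
    have h2 : Measure.infinitePi (fun _ : ℕ => m) {X : ℕ → ℝ | tau (k * ε) X = ⊤} = 0 := by
      simpa [ae_iff] using ih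
    rw [h2, nonpos_iff_eq_zero, mul_eq_zero, or_iff_right hp.ne'] at h1
    simpa [ae_iff] using h1

/-- The exit time is monotone in the level, so countably many levels suffice and the null set does
not depend on `y`. -/
lemma ae_forall_tau_lt_top
    (hpos : 0 < m (Set.Ioi 0))
    (h0 : ∀ᵐ X ∂(Measure.infinitePi fun _ : ℕ => m), tau 0 X < ⊤) :
    ∀ᵐ X ∂(Measure.infinitePi fun _ : ℕ => m), ∀ y, tau y X < ⊤ := by
  obtain ⟨ε, hε, hp⟩ := exists_pos_measure_Ioi hpos
  filter_upwards [ae_all_iff.2 (ae_tau_nat_lt_top m hε hp h0)] with X hX y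
  obtain ⟨k, hk⟩ := exists_nat_ge (y / ε)
  exact (tau_mono ((div_le_iff₀ hε).1 hk) X).trans_lt (hX k)

/-- The mean exit position is finite for every starting point. -/
lemma lintegral_negExit_lt_top (hsq : ∫⁻ x, ENNReal.ofReal (x ^ 2) ∂m < ∞)
    (hpos : 0 < m (Set.Ioi 0)) (hplus : ∫⁻ x, ENNReal.ofReal x ∂m < ∞)
    (hfin : ∀ᵐ X ∂(Measure.infinitePi fun _ : ℕ => m), ∀ y, tau y X < ⊤) (y : ℝ) :
    ∫⁻ X, negExit y X ∂(Measure.infinitePi fun _ : ℕ => m) < ∞ := by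
  obtain ⟨ε, hε, hp⟩ := exists_pos_measure_Ioi hpos
  have key : ∀ k : ℕ, ∫⁻ X, negExit (k * ε) X ∂(Measure.infinitePi fun _ : ℕ => m) < ∞ := by
    intro k
    induction k with
    | zero => simpa using lintegral_negExit_zero_lt_top m hsq hpos
    | succ k ih =>
      have h0m : Measurable fun X : ℕ → ℝ => ENNReal.ofReal (X 0) := by fun_prop
      -- The summand `ENNReal.ofReal (X 0)` is the price of restarting the walk after its first step
      -- in `negExit_splice`; its mean is finite.
      have h1 := measure_Ioi_mul_lintegral_le m (ε := ε)
        (f := fun X => negExit (k * ε) X + ENNReal.ofReal (X 0))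
        (g := negExit ((k + 1 : ℕ) * ε)) ((measurable_negExit_right _).add h0m) (by
          intro X hX
          filter_upwards [hfin] with X' hX'
          have hw : walk X 1 = X 0 := by simp [walk]
          have hk : 0 ≤ (k : ℝ) * ε := by positivity
          have h2 := negExit_splice (y := k * ε) (k := 1) (X := X) (X' := X') hk
            (fun i hi hi1 => by
              obtain rfl : i = 1 := le_antisymm hi1 hi
              rw [hw]; linarith) (hX' _)
          rw [hw] at h2
          have h3 : splice 1 X X' 0 = X 0 := by simp [splice]
          rw [h3, h2]
          refine le_trans (negExit_mono ?_ (hX' _)) le_self_add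
          push_cast; linarith)
      rw [lintegral_add_right _ h0m, lintegral_infinitePi_eval (fun _ : ℕ => m) 0
        ENNReal.measurable_ofReal] at h1
      have h2 := h1.trans_lt (ENNReal.add_lt_top.2 ⟨ih, hplus⟩)
      exact (ENNReal.mul_lt_top_iff.1 h2).elim (fun h => h.2) fun h =>
        h.elim (fun h => absurd h hp.ne') fun h => by rw [h]; exact ENNReal.zero_lt_top
  obtain ⟨k, hk⟩ := exists_nat_ge (y / ε)
  refine lt_of_le_of_lt (lintegral_mono_ae ?_) (key k)
  filter_upwards [hfin] with X hX
  exact negExit_mono ((div_le_iff₀ hε).1 hk) (hX _)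

/-- Reflection: the walk with steps `-X i` falls strictly below 0, which for the original walk means
rising above 0. Centring makes the reflected steps nondegenerate in the required direction. -/
lemma ae_ladderEpoch_lt_top (hint : Integrable id m) (hmean : ∫ x, x ∂m = 0)
    (hsq : ∫⁻ x, ENNReal.ofReal (x ^ 2) ∂m < ∞) (hpos : 0 < m (Set.Ioi 0)) :
    ∀ᵐ X ∂(Measure.infinitePi fun _ : ℕ => m), ladderEpoch (walk X) < ⊤ := by
  set m' := m.map fun x => -x with hm'
  have hprob : IsProbabilityMeasure m' := Measure.isProbabilityMeasure_map (by fun_prop)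
  have hpos' : 0 < m' (Set.Ioi 0) := by
    rw [hm', Measure.map_apply measurable_neg measurableSet_Ioi]
    have h1 : (fun x : ℝ => -x) ⁻¹' Set.Ioi 0 = Set.Iio 0 := by ext; simp
    rw [h1]
    exact measure_Iio_pos_of_integral_eq_zero hint hmean hpos
  have hsq' : ∫⁻ x, ENNReal.ofReal (x ^ 2) ∂m' < ∞ := by
    rw [hm', lintegral_map (by fun_prop) measurable_neg]
    simpa using hsq
  have hint' : Integrable id m' := by
    rw [hm', integrable_map_measure (by fun_prop) (by fun_prop)]
    exact hint.neg
  have hmean' : ∫ x, x ∂m' = 0 := by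
    rw [hm', integral_map (by fun_prop) (by fun_prop), integral_neg, hmean, neg_zero]
  have h1 := ae_tau_zero_lt_top m' hint' hmean'
    (lintegral_negExit_zero_lt_top m' hsq' hpos') hpos'
  have h2 := Measure.infinitePi_map_pi (fun _ : ℕ => m) (f := fun _ x => -x)
    fun _ => measurable_neg
  rw [← hm'] at h2
  rw [← h2] at h1
  have hm_neg : Measurable fun (X : ℕ → ℝ) i => -X i := by fun_prop
  filter_upwards [ae_of_ae_map hm_neg.aemeasurable h1] with X hX
  obtain ⟨n, hn⟩ := exists_tau_eq hX
  have h3 := (tau_eq_coe_iff.1 hn).1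
  have h4 : walk (fun i => -X i) n = -walk X n := by simp [walk]
  rw [h4] at h3
  refine lt_of_le_of_lt (iInf₂_le n ⟨h3.1, ?_⟩) (ENat.natCast_lt_top n)
  rw [walk_zero]
  linarith [h3.2]

end RWRE
end

noncomputable section

namespace RWRE
variable {E : Type*}

/-! ### The harmonic function in a fixed environment -/

lemma iterate_shift_apply (k n : ℕ) (e : ℕ → E) : shift^[k] e n = e (n + k) := by
  induction k generalizing e with
  | zero => rfl
  | succ k ih => rw [Function.iterate_succ_apply, ih]; simp [shift, add_assoc]

variable [MeasurableSpace E] (𝓛 : Kernel E (Measure ℝ))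

lemma lintegral_quenchedSteps_splice (e : ℕ → E) (k : ℕ) {f : (ℕ → ℝ) → ℝ≥0∞}
    (hf : Measurable f) :
    ∫⁻ X, f X ∂(quenchedSteps 𝓛 e) =
      ∫⁻ X, ∫⁻ X', f (splice k X X') ∂(quenchedSteps 𝓛 (shift^[k] e)) ∂(quenchedSteps 𝓛 e) := by
  have h : quenchedSteps 𝓛 (shift^[k] e) =
      Measure.infinitePi fun n => stepLaw 𝓛 (e (n + k)) := by
    simp only [← iterate_shift_apply]; rfl
  rw [h]
  exact lintegral_infinitePi_splice (fun n => stepLaw 𝓛 (e n)) k hf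

lemma lintegral_quenchedSteps_eval (e : ℕ → E) (k : ℕ) {f : ℝ → ℝ≥0∞} (hf : Measurable f) :
    ∫⁻ X, f (X k) ∂(quenchedSteps 𝓛 e) = ∫⁻ x, f x ∂(stepLaw 𝓛 (e k)) :=
  lintegral_infinitePi_eval (fun n => stepLaw 𝓛 (e n)) k hf

/-- The environments in which the walk is centred and recurrent, with integrable exit positions. -/
structure GoodEnv (e : ℕ → E) : Prop where
  mean_eq (n : ℕ) : ∫⁻ x, ENNReal.ofReal x ∂(stepLaw 𝓛 (e n)) =
    ∫⁻ x, ENNReal.ofReal (-x) ∂(stepLaw 𝓛 (e n))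
  mean_lt_top (n : ℕ) : ∫⁻ x, ENNReal.ofReal x ∂(stepLaw 𝓛 (e n)) < ∞
  tau_lt_top (n : ℕ) : ∀ᵐ X ∂(quenchedSteps 𝓛 (shift^[n] e)), ∀ y, tau y X < ⊤
  harmonicU_lt_top' (n : ℕ) (y : ℝ) : harmonicU 𝓛 (shift^[n] e) y < ∞

variable {𝓛} {e : ℕ → E}

lemma GoodEnv.iterate (he : GoodEnv 𝓛 e) (k : ℕ) : GoodEnv 𝓛 (shift^[k] e) where
  mean_eq n := by rw [iterate_shift_apply]; exact he.mean_eq _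
  mean_lt_top n := by rw [iterate_shift_apply]; exact he.mean_lt_top _
  tau_lt_top n := by rw [← Function.iterate_add_apply]; exact he.tau_lt_top _
  harmonicU_lt_top' n y := by rw [← Function.iterate_add_apply]; exact he.harmonicU_lt_top' _ _

lemma GoodEnv.ae_tau (he : GoodEnv 𝓛 e) : ∀ᵐ X ∂(quenchedSteps 𝓛 e), ∀ y, tau y X < ⊤ :=
  he.tau_lt_top 0

lemma GoodEnv.harmonicU_lt_top (he : GoodEnv 𝓛 e) (y : ℝ) : harmonicU 𝓛 e y < ∞ :=
  he.harmonicU_lt_top' 0 y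

lemma GoodEnv.harmonicU_pos (he : GoodEnv 𝓛 e) {y : ℝ} (hy : 0 ≤ y) : 0 < harmonicU 𝓛 e y := by
  rw [pos_iff_ne_zero]
  intro h
  rw [harmonicU, lintegral_eq_zero_iff (measurable_negExit_right y)] at h
  obtain ⟨X, h1, h2⟩ := (h.and he.ae_tau).exists
  exact (negExit_pos hy (h2 y)).ne' h1

lemma measurable_harmonicU_right (e : ℕ → E) : Measurable (harmonicU 𝓛 e) := by
  have h := (measurable_harmonicU 𝓛).comp
    ((measurable_const (a := e)).prodMk (measurable_id (α := ℝ)))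
  simpa only [Function.comp_def, id_eq] using h

/-- `U` is harmonic for the walk killed when it becomes negative. -/
lemma GoodEnv.harmonicU_eq (he : GoodEnv 𝓛 e) {y : ℝ} (hy : 0 ≤ y) :
    ∫⁻ x, (Set.Ici 0).indicator (harmonicU 𝓛 (shift e)) (y + x) ∂(stepLaw 𝓛 (e 0)) =
      harmonicU 𝓛 e y := by
  have hU : Measurable fun x : ℝ => (Set.Ici 0).indicator (harmonicU 𝓛 (shift e)) (y + x) :=
    ((measurable_harmonicU_right _).indicator measurableSet_Ici).comp (measurable_const_add y)
  have hp : Measurable fun X : ℕ → ℝ => ENNReal.ofReal (X 0) := by fun_prop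
  have hn : Measurable fun X : ℕ → ℝ => ENNReal.ofReal (-X 0) := by fun_prop
  -- Decomposition at the first step, with the two parts of `X 0` placed on opposite sides. They
  -- have equal finite means and cancel at the end.
  have h1 : ∫⁻ X, (negExit y X + ENNReal.ofReal (X 0)) ∂(quenchedSteps 𝓛 e) =
      ∫⁻ X, ((Set.Ici 0).indicator (harmonicU 𝓛 (shift e)) (y + X 0) + ENNReal.ofReal (-X 0))
        ∂(quenchedSteps 𝓛 e) := by
    rw [lintegral_quenchedSteps_splice 𝓛 e 1
      (f := fun X => negExit y X + ENNReal.ofReal (X 0)) ((measurable_negExit_right y).add hp)]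
    refine lintegral_congr fun X => ?_
    have hw : walk X 1 = X 0 := by simp [walk]
    have h3 : ∀ X', splice 1 X X' 0 = X 0 := by simp [splice]
    simp only [h3]
    by_cases hX : 0 ≤ y + X 0
    · rw [Set.indicator_of_mem (by exact hX)]
      have h4 : ∀ᵐ X' ∂(quenchedSteps 𝓛 (shift^[1] e)),
          negExit y (splice 1 X X') + ENNReal.ofReal (X 0) =
            negExit (y + X 0) X' + ENNReal.ofReal (-X 0) := by
        filter_upwards [he.tau_lt_top 1] with X' hX'
        have h2 := negExit_splice (y := y) (k := 1) (X := X) (X' := X') hy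
          (fun i hi hi1 => by
            obtain rfl : i = 1 := le_antisymm hi1 hi
            rwa [hw]) (hX' _)
        rwa [hw] at h2
      rw [lintegral_congr_ae h4, lintegral_add_right _ measurable_const, lintegral_const,
        measure_univ, mul_one]
      rfl
    · rw [Set.indicator_of_notMem (by exact hX), zero_add]
      have h4 : ∀ X', negExit y (splice 1 X X') + ENNReal.ofReal (X 0) =
          ENNReal.ofReal (-X 0) := by
        intro X'
        have h5 : walk (splice 1 X X') 1 = X 0 := by rw [walk_splice_of_le le_rfl, hw]
        have h6 : tau y (splice 1 X X') = (1 : ℕ) :=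
          tau_eq_coe_iff.2 ⟨⟨le_rfl, by rw [h5]; exact not_le.1 hX⟩, by omega⟩
        rw [negExit_of_tau_eq h6, h5, ENNReal.ofReal_of_nonpos (p := X 0) (by linarith), add_zero]
      simp only [h4, lintegral_const, measure_univ, mul_one]
  rw [lintegral_add_right _ hp, lintegral_add_right _ hn,
    lintegral_quenchedSteps_eval 𝓛 e 0 ENNReal.measurable_ofReal,
    lintegral_quenchedSteps_eval 𝓛 e 0 (f := fun x => ENNReal.ofReal (-x)) (by fun_prop),
    lintegral_quenchedSteps_eval 𝓛 e 0 hU, ← he.mean_eq 0] at h1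
  exact ((ENNReal.add_left_inj (he.mean_lt_top 0).ne).1 h1).symm

lemma lintegral_walkStep (q : (ℕ → E) × ℝ) {g : ℝ → ℝ≥0∞} (hg : Measurable g) :
    ∫⁻ y, g y ∂(walkStep 𝓛 q) = ∫⁻ x, g (q.2 + x) ∂(stepLaw 𝓛 (q.1 0)) := by
  have hadd : Measurable fun r : ((ℕ → E) × ℝ) × ℝ => r.1.2 + r.2 := by fun_prop
  have hcomp : Measurable fun r : ((ℕ → E) × ℝ) × ℝ => g (r.1.2 + r.2) := hg.comp hadd
  rw [walkStep, Kernel.map_apply _ hadd, lintegral_map hg hadd, Kernel.prod_apply,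
    Kernel.id_apply, lintegral_prod _ hcomp.aemeasurable,
    lintegral_dirac' _ hcomp.lintegral_prod_right']
  rfl

/-- Harmonicity of U says exactly that the `h`-transformed kernel has mass 1, so `probPart` changes
nothing here. -/
lemma GoodEnv.condStep_eq (he : GoodEnv 𝓛 e) {x : ℝ} (hx : 0 ≤ x) :
    condStep 𝓛 (e, x) = (walkStep 𝓛 (e, x)).withDensity (hDensity 𝓛 (e, x)) := by
  have hm : Measurable (hDensity 𝓛 (e, x)) := (measurable_hDensity 𝓛).of_uncurry_left
  have h1 := Kernel.withDensity_apply (walkStep 𝓛) (measurable_hDensity 𝓛) (e, x)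
  have hmass : Kernel.withDensity (walkStep 𝓛) (hDensity 𝓛) (e, x) Set.univ = 1 := by
    rw [h1, withDensity_apply _ MeasurableSet.univ, Measure.restrict_univ,
      lintegral_walkStep _ hm]
    have h2 : ∀ z, hDensity 𝓛 (e, x) (x + z) =
        (Set.Ici 0).indicator (harmonicU 𝓛 (shift e)) (x + z) * (harmonicU 𝓛 e x)⁻¹ := by
      intro z
      rw [hDensity, div_eq_mul_inv]
      rfl
    have hU : Measurable fun z : ℝ => (Set.Ici 0).indicator (harmonicU 𝓛 (shift e)) (x + z) :=
      ((measurable_harmonicU_right _).indicator measurableSet_Ici).comp (measurable_const_add x)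
    simp only [h2]
    rw [lintegral_mul_const _ hU, he.harmonicU_eq hx,
      ENNReal.mul_inv_cancel (he.harmonicU_pos hx).ne' (he.harmonicU_lt_top x).ne]
  rw [condStep, probPart, Kernel.piecewise_apply, if_pos (by exact hmass), h1]

/-- Multiplying by the denominator of the density, which is positive and finite, lets the ratios
telescope along the path. -/
lemma GoodEnv.harmonicU_mul_lintegral_condStep (he : GoodEnv 𝓛 e) {x : ℝ} (hx : 0 ≤ x)
    {g : ℝ → ℝ≥0∞} (hg : Measurable g) :
    harmonicU 𝓛 e x * ∫⁻ y, g y ∂(condStep 𝓛 (e, x)) =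
      ∫⁻ z, (Set.Ici 0).indicator (fun y => g y * harmonicU 𝓛 (shift e) y) (x + z)
        ∂(stepLaw 𝓛 (e 0)) := by
  have hm : Measurable (hDensity 𝓛 (e, x)) := (measurable_hDensity 𝓛).of_uncurry_left
  rw [he.condStep_eq hx, lintegral_withDensity_eq_lintegral_mul _ hm hg,
    lintegral_walkStep _ (hm.mul hg), ← lintegral_const_mul]
  · refine lintegral_congr fun z => ?_
    simp only [Pi.mul_apply, hDensity, Set.indicator, Set.mem_Ici]
    split_ifs
    · rw [← mul_assoc, ENNReal.mul_div_cancel (he.harmonicU_pos hx).ne'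
        (he.harmonicU_lt_top x).ne, mul_comm]
    · simp
  · exact (hm.mul hg).comp (measurable_const_add x)

end RWRE
end

noncomputable section

namespace RWRE
variable {E : Type*} [MeasurableSpace E]

/-! ### Finite-dimensional laws of the conditioned walk -/

/-- Given the first `n` coordinates, the next has law `κ n`; a function that sees nothing later can
be integrated over that coordinate alone. This is the induction step for the finite-dimensional
laws. -/
lemma lintegral_traj_succ {S : Type*} [MeasurableSpace S]
    (κ : (n : ℕ) → Kernel ((i : Finset.Iic n) → S) S) [∀ n, IsMarkovKernel (κ n)]
    (x₀ : (i : Finset.Iic 0) → S) (n : ℕ) {F : (ℕ → S) → ℝ≥0∞} (hF : Measurable F)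
    (hdep : DependsOn F (Set.Iic (n + 1))) :
    ∫⁻ h, F h ∂(Kernel.traj (X := fun _ : ℕ => S) κ 0 x₀) =
      ∫⁻ h, ∫⁻ y, F (Function.update h (n + 1) y) ∂(κ n (Preorder.frestrictLe n h))
        ∂(Kernel.traj (X := fun _ : ℕ => S) κ 0 x₀) := by
  conv_lhs => rw [← Kernel.traj_comp_partialTraj (X := fun _ : ℕ => S) (κ := κ) (Nat.zero_le n),
    Kernel.lintegral_comp _ _ _ hF, ← Kernel.traj_map_frestrictLe_apply]
  rw [lintegral_map hF.lintegral_kernel (Preorder.measurable_frestrictLe n)]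
  refine lintegral_congr fun h => ?_
  have hup : Measurable fun y : S => F (Function.update h (n + 1) y) :=
    hF.comp (measurable_update h)
  have h1 : κ n (Preorder.frestrictLe n h) =
      (Kernel.traj (X := fun _ : ℕ => S) κ n (Preorder.frestrictLe n h)).map
        fun x => x (n + 1) := by
    rw [← Kernel.map_apply _ (measurable_pi_apply (n + 1)), Kernel.map_traj_succ_self]
  rw [h1, lintegral_map hup (measurable_pi_apply (n + 1)), Kernel.lintegral_traj _ hF]
  refine lintegral_congr fun x => hdep fun i hi => ?_
  rcases Nat.lt_succ_iff_lt_or_eq.1 (Nat.lt_succ_of_le (Set.mem_Iic.1 hi)) with hlt | rfl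
  · have : i ∈ Finset.Iic n := Finset.mem_Iic.2 (Nat.lt_succ_iff.1 hlt)
    simp [Function.updateFinset, this, Function.update_of_ne hlt.ne]
  · simp [Function.updateFinset]

variable {𝓛 : Kernel E (Measure ℝ)} {e : ℕ → E}

lemma lintegral_envCondStep (q : (ℕ → E) × ℝ) {g : (ℕ → E) × ℝ → ℝ≥0∞} (hg : Measurable g) :
    ∫⁻ p, g p ∂(envCondStep 𝓛 q) = ∫⁻ y, g (shift q.1, y) ∂(condStep 𝓛 q) := by
  rw [envCondStep, Kernel.prod_apply, Kernel.deterministic_apply,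
    lintegral_prod _ hg.aemeasurable, lintegral_dirac' _ hg.lintegral_prod_right']

/-- The joint path of the shifted environments and of the walk. -/
def envPath (e : ℕ → E) (X : ℕ → ℝ) (i : ℕ) : (ℕ → E) × ℝ := (shift^[i] e, walk X i)

lemma measurable_envPath (e : ℕ → E) : Measurable (envPath e) :=
  measurable_pi_lambda _ fun i => measurable_const.prodMk (measurable_walk i)

/-- The walk is non-negative up to time `n`. -/
def stayNonneg (n : ℕ) : Set (ℕ → ℝ) := {X | ∀ i ≤ n, 0 ≤ walk X i}

lemma measurableSet_stayNonneg (n : ℕ) : MeasurableSet (stayNonneg n) := by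
  have := measurable_walk
  unfold stayNonneg
  measurability

lemma splice_mem_stayNonneg_succ {n : ℕ} {X X' : ℕ → ℝ} :
    splice n X X' ∈ stayNonneg (n + 1) ↔ X ∈ stayNonneg n ∧ 0 ≤ walk X n + X' 0 := by
  have h1 : walk (splice n X X') (n + 1) = walk X n + X' 0 := by
    rw [walk_splice_add]; simp [walk]
  constructor
  · refine fun h => ⟨fun i hi => ?_, h1 ▸ h (n + 1) le_rfl⟩
    have := h i (by omega)
    rwa [walk_splice_of_le hi] at this
  · rintro ⟨h2, h3⟩ i hi
    rcases hi.eq_or_lt with rfl | hlt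
    · rwa [h1]
    · rw [walk_splice_of_le (by omega)]; exact h2 i (by omega)

/-- The law of the first `n` values of the conditioned walk is an `h`-transform. -/
lemma GoodEnv.harmonicU_mul_lintegral_envCondChain (he : GoodEnv 𝓛 e) (n : ℕ)
    {F : (ℕ → (ℕ → E) × ℝ) → ℝ≥0∞} (hF : Measurable F) (hdep : DependsOn F (Set.Iic n)) :
    harmonicU 𝓛 e 0 * ∫⁻ h, F h ∂(envCondChain 𝓛 (e, 0)) =
      ∫⁻ X, (stayNonneg n).indicator
        (fun X => F (envPath e X) * harmonicU 𝓛 (shift^[n] e) (walk X n)) X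
        ∂(quenchedSteps 𝓛 e) := by
  rw [envCondChain, Kernel.comap_apply]
  induction n generalizing F with
  | zero =>
    rw [Kernel.lintegral_traj _ hF]
    have h1 : ∀ h : ℕ → (ℕ → E) × ℝ, F (Function.updateFinset h (Finset.Iic 0) fun _ => (e, 0)) =
        F fun _ => (e, 0) := fun h => hdep fun i hi => by
      obtain rfl : i = 0 := by simpa using hi
      simp [Function.updateFinset]
    have h2 : ∀ X, (stayNonneg 0).indicator
        (fun X => F (envPath e X) * harmonicU 𝓛 (shift^[0] e) (walk X 0)) X =
          (F fun _ => (e, 0)) * harmonicU 𝓛 e 0 := fun X => by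
      rw [Set.indicator_of_mem]
      · rw [walk_zero]
        congr 1
        refine hdep fun i hi => ?_
        obtain rfl : i = 0 := by simpa using hi
        simp [envPath]
      · intro i hi
        obtain rfl : i = 0 := by simpa using hi
        simp
    simp only [h1, h2, lintegral_const, measure_univ, mul_one]
    exact mul_comm _ _
  | succ n ih =>
    rw [lintegral_traj_succ _ _ n hF hdep]
    -- Integrating out the last coordinate leaves a function of the path up to time `n`, to which
    -- the induction hypothesis applies.
    have hG : Measurable fun h : ℕ → (ℕ → E) × ℝ =>
        ∫⁻ p, F (Function.update h (n + 1) p) ∂(envCondStep 𝓛 (h n)) :=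
      Measurable.lintegral_kernel_prod_right'
        (κ := (envCondStep 𝓛).comap (fun h : ℕ → (ℕ → E) × ℝ => h n) (measurable_pi_apply n))
        (hF.comp measurable_update')
    have hGdep : DependsOn (fun h : ℕ → (ℕ → E) × ℝ =>
        ∫⁻ p, F (Function.update h (n + 1) p) ∂(envCondStep 𝓛 (h n))) (Set.Iic n) := by
      intro h h' hh
      simp only [hh n (Set.mem_Iic.2 le_rfl)]
      refine lintegral_congr fun p => hdep fun i hi => ?_
      by_cases hin : i = n + 1
      · subst hin; simp
      · rw [Function.update_of_ne hin, Function.update_of_ne hin]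
        exact hh i (by have := Set.mem_Iic.1 hi; exact Set.mem_Iic.2 (by omega))
    refine (ih hG hGdep).trans ?_
    have hR : Measurable ((stayNonneg (n + 1)).indicator
        fun X => F (envPath e X) * harmonicU 𝓛 (shift^[n + 1] e) (walk X (n + 1))) :=
      ((hF.comp (measurable_envPath e)).mul ((measurable_harmonicU_right _).comp
        (measurable_walk _))).indicator (measurableSet_stayNonneg _)
    rw [lintegral_quenchedSteps_splice 𝓛 e n hR]
    refine lintegral_congr fun X => ?_
    by_cases hX : X ∈ stayNonneg n
    · rw [Set.indicator_of_mem hX]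
      have hg : Measurable fun y => F (Function.update (envPath e X) (n + 1)
          (shift (shift^[n] e), y)) :=
        hF.comp ((measurable_update _).comp (measurable_const.prodMk measurable_id))
      have h1 := (he.iterate n).harmonicU_mul_lintegral_condStep (hX n le_rfl) hg
      have h2 := lintegral_envCondStep (𝓛 := 𝓛) (envPath e X n)
        (g := fun p => F (Function.update (envPath e X) (n + 1) p))
        (hF.comp (measurable_update _))
      rw [h2, mul_comm]
      refine h1.trans ?_
      have hm : Measurable fun z : ℝ => (Set.Ici 0).indicator
          (fun y => F (Function.update (envPath e X) (n + 1) (shift (shift^[n] e), y)) *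
            harmonicU 𝓛 (shift (shift^[n] e)) y) (walk X n + z) :=
        ((hg.mul (measurable_harmonicU_right _)).indicator measurableSet_Ici).comp
          (measurable_const_add _)
      rw [← lintegral_quenchedSteps_eval 𝓛 (shift^[n] e) 0 hm]
      refine lintegral_congr fun X' => ?_
      have hw : walk (splice n X X') (n + 1) = walk X n + X' 0 := by
        rw [walk_splice_add]; simp [walk]
      by_cases hX' : 0 ≤ walk X n + X' 0
      · rw [Set.indicator_of_mem (by exact hX'),
          Set.indicator_of_mem (splice_mem_stayNonneg_succ.2 ⟨hX, hX'⟩), hw,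
          Function.iterate_succ_apply']
        congr 1
        refine hdep fun i hi => ?_
        by_cases hin : i = n + 1
        · subst hin
          simp [envPath, hw, Function.iterate_succ_apply']
        · have hi' : i ≤ n := by have := Set.mem_Iic.1 hi; omega
          rw [Function.update_of_ne hin, envPath, envPath, walk_splice_of_le hi']
      · rw [Set.indicator_of_notMem (by exact hX'), Set.indicator_of_notMem]
        exact fun h => hX' (splice_mem_stayNonneg_succ.1 h).2
    · rw [Set.indicator_of_notMem hX]
      have h1 : ∀ X', (stayNonneg (n + 1)).indicator
        (fun X => F (envPath e X) * harmonicU 𝓛 (shift^[n + 1] e) (walk X (n + 1)))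
          (splice n X X') = 0 := fun X' =>
        Set.indicator_of_notMem (fun h => hX (splice_mem_stayNonneg_succ.1 h).1) _
      simp only [h1, lintegral_zero]

end RWRE
end

noncomputable section

namespace RWRE
variable {E : Type*} [MeasurableSpace E] {𝓛 : Kernel E (Measure ℝ)} {e : ℕ → E}

lemma GoodEnv.harmonicU_mul_lintegral_conditionedWalk (he : GoodEnv 𝓛 e) (n : ℕ)
    {f : (ℕ → ℝ) → ℝ≥0∞} (hf : Measurable f) (hdep : DependsOn f (Set.Iic n)) :
    harmonicU 𝓛 e 0 * ∫⁻ ζ, f ζ ∂(conditionedWalk 𝓛 e) =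
      ∫⁻ X, (stayNonneg n).indicator
        (fun X => f (walk X) * harmonicU 𝓛 (shift^[n] e) (walk X n)) X
        ∂(quenchedSteps 𝓛 e) := by
  have hproj : Measurable fun (h : ℕ → (ℕ → E) × ℝ) (n : ℕ) => (h n).2 :=
    measurable_pi_lambda _ fun n => measurable_snd.comp (measurable_pi_apply n)
  rw [conditionedWalk, Kernel.map_apply _ hproj, lintegral_map hf hproj, Kernel.comap_apply]
  refine he.harmonicU_mul_lintegral_envCondChain n (hf.comp hproj) fun h h' hh => ?_
  exact hdep fun i hi => by rw [hh i hi]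

/-! ### The conditioned walk never falls below its present value -/

/-- The part of the mean exit position from `y` due to the paths that stay non-negative for a
time `n` before falling below `-y`. -/
def lateExit (𝓛 : Kernel E (Measure ℝ)) (e : ℕ → E) (y : ℝ) (n : ℕ) : ℝ≥0∞ :=
  ∫⁻ X, (stayNonneg n).indicator (negExit y) X ∂(quenchedSteps 𝓛 e)

/-- The mean position at time `n` on the event that the walk stays non-negative. -/
def meanNonneg (𝓛 : Kernel E (Measure ℝ)) (e : ℕ → E) (n : ℕ) : ℝ≥0∞ :=
  ∫⁻ X, (stayNonneg n).indicator (fun X => ENNReal.ofReal (walk X n)) X ∂(quenchedSteps 𝓛 e)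

lemma splice_mem_stayNonneg {n : ℕ} {X X' : ℕ → ℝ} :
    splice n X X' ∈ stayNonneg n ↔ X ∈ stayNonneg n :=
  forall₂_congr fun i hi => by rw [walk_splice_of_le hi]

/-- The Markov property at time `n`: as long as S ≥ 0, the walk started from `y` has not exited
either, and restarting it shifts the exit position by S_n ≥ 0. -/
lemma GoodEnv.lintegral_stayNonneg_harmonicU (he : GoodEnv 𝓛 e) {y : ℝ} (hy : 0 ≤ y) (n : ℕ) :
    ∫⁻ X, (stayNonneg n).indicator
      (fun X => harmonicU 𝓛 (shift^[n] e) (y + walk X n)) X ∂(quenchedSteps 𝓛 e) =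
      lateExit 𝓛 e y n + meanNonneg 𝓛 e n := by
  have hs := measurableSet_stayNonneg n
  have hw : Measurable fun X : ℕ → ℝ => ENNReal.ofReal (walk X n) :=
    ENNReal.measurable_ofReal.comp (measurable_walk n)
  have hsum : Measurable ((stayNonneg n).indicator
      fun X : ℕ → ℝ => negExit y X + ENNReal.ofReal (walk X n)) :=
    ((measurable_negExit_right y).add hw).indicator hs
  have h1 : lateExit 𝓛 e y n + meanNonneg 𝓛 e n =
      ∫⁻ X, (stayNonneg n).indicator
        (fun X => negExit y X + ENNReal.ofReal (walk X n)) X ∂(quenchedSteps 𝓛 e) := by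
    rw [lateExit, meanNonneg, ← lintegral_add_right _ (hw.indicator hs)]
    refine lintegral_congr fun X => ?_
    rw [Set.indicator_add]
  rw [h1, lintegral_quenchedSteps_splice 𝓛 e n hsum]
  refine lintegral_congr fun X => ?_
  by_cases hX : X ∈ stayNonneg n
  · rw [Set.indicator_of_mem hX, harmonicU]
    refine lintegral_congr_ae ?_
    filter_upwards [he.tau_lt_top n] with X' hX'
    rw [Set.indicator_of_mem (splice_mem_stayNonneg.2 hX), walk_splice_of_le le_rfl,
      negExit_splice hy (fun i _ hi => add_nonneg hy (hX i hi)) (hX' _),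
      ENNReal.ofReal_of_nonpos (neg_nonpos.2 (hX n le_rfl)), add_zero]
  · rw [Set.indicator_of_notMem hX]
    have h2 : ∀ X', (stayNonneg n).indicator
        (fun X => negExit y X + ENNReal.ofReal (walk X n)) (splice n X X') = 0 := fun X' =>
      Set.indicator_of_notMem (fun h => hX (splice_mem_stayNonneg.1 h)) _
    simp only [h2, lintegral_zero]

lemma GoodEnv.lintegral_stayNonneg_harmonicU_zero (he : GoodEnv 𝓛 e) (n : ℕ) :
    ∫⁻ X, (stayNonneg n).indicator
      (fun X => harmonicU 𝓛 (shift^[n] e) (walk X n)) X ∂(quenchedSteps 𝓛 e) =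
      harmonicU 𝓛 e 0 := by
  have h := he.harmonicU_mul_lintegral_conditionedWalk n (f := fun _ => 1) measurable_const
    fun _ _ _ => rfl
  simpa using h.symm

lemma lateExit_le (y : ℝ) (n : ℕ) : lateExit 𝓛 e y n ≤ harmonicU 𝓛 e y :=
  lintegral_mono fun X => Set.indicator_le_self _ _ X

/-- For `y = 0` the left side of `GoodEnv.lintegral_stayNonneg_harmonicU` is the total mass of the
`h`-transform, whatever `n` is. -/
lemma GoodEnv.lateExit_add_meanNonneg (he : GoodEnv 𝓛 e) (n : ℕ) :
    lateExit 𝓛 e 0 n + meanNonneg 𝓛 e n = harmonicU 𝓛 e 0 := by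
  rw [← he.lintegral_stayNonneg_harmonicU le_rfl n]
  simpa only [zero_add] using he.lintegral_stayNonneg_harmonicU_zero n

/-- Almost every path becomes negative at a finite time, after which it leaves `stayNonneg n`; the
exit position from `y` dominates. -/
lemma GoodEnv.tendsto_lateExit (he : GoodEnv 𝓛 e) (y : ℝ) :
    Filter.Tendsto (lateExit 𝓛 e y) Filter.atTop (nhds 0) := by
  have h := tendsto_lintegral_of_dominated_convergence (μ := quenchedSteps 𝓛 e)
    (F := fun n => (stayNonneg n).indicator (negExit y)) (f := fun _ => 0) (negExit y)
    (fun n => (measurable_negExit_right y).indicator (measurableSet_stayNonneg n))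
    (fun n => Filter.Eventually.of_forall fun X => Set.indicator_le_self _ _ X)
    (he.harmonicU_lt_top y).ne (by
      filter_upwards [he.ae_tau] with X hX
      obtain ⟨k, hk⟩ := exists_tau_eq (hX 0)
      refine tendsto_const_nhds.congr' ?_
      filter_upwards [Filter.eventually_ge_atTop k] with n hn
      rw [Set.indicator_of_notMem]
      intro h
      have h1 := h k hn
      have h2 := (tau_eq_coe_iff.1 hk).1.2
      linarith)
  rw [lintegral_zero] at h
  exact h

/-- The limit is free of `y`: `meanNonneg` does not involve `y`, and the balance at `y = 0`
identifies its limit. This is what decouples the future of the path from the height of its minimum.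
-/
lemma GoodEnv.tendsto_lateExit_add_meanNonneg (he : GoodEnv 𝓛 e) (y : ℝ) :
    Filter.Tendsto (fun n => lateExit 𝓛 e y n + meanNonneg 𝓛 e n) Filter.atTop
      (nhds (harmonicU 𝓛 e 0)) := by
  have hU := (he.harmonicU_lt_top 0).ne
  have h1 : ∀ n, meanNonneg 𝓛 e n = harmonicU 𝓛 e 0 - lateExit 𝓛 e 0 n := fun n =>
    ENNReal.eq_sub_of_add_eq' hU (by rw [add_comm]; exact he.lateExit_add_meanNonneg n)
  have h2 : Filter.Tendsto (meanNonneg 𝓛 e) Filter.atTop (nhds (harmonicU 𝓛 e 0)) := by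
    have h3 := ENNReal.Tendsto.sub (tendsto_const_nhds (x := harmonicU 𝓛 e 0))
      (he.tendsto_lateExit 0) (Or.inl hU)
    rw [tsub_zero] at h3
    exact h3.congr fun n => (h1 n).symm
  simpa using (he.tendsto_lateExit y).add h2

/-- The event that the path lies in `B` and does not fall below its value at time `k` during the
next `n` steps. -/
def stayAbove (B : Set (ℕ → ℝ)) (k n : ℕ) : Set (ℕ → ℝ) :=
  {ζ | ζ ∈ B ∧ ∀ j ≤ n, ζ k ≤ ζ (k + j)}

lemma measurableSet_stayAbove {B : Set (ℕ → ℝ)} (hB : MeasurableSet B) (k n : ℕ) :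
    MeasurableSet (stayAbove B k n) := by
  have h1 : stayAbove B k n = B ∩ ⋂ (j : ℕ) (_ : j ≤ n), {ζ : ℕ → ℝ | ζ k ≤ ζ (k + j)} := by
    ext; simp [stayAbove]
  rw [h1]
  exact hB.inter (MeasurableSet.iInter fun j => MeasurableSet.iInter fun _ =>
    measurableSet_le (measurable_pi_apply _) (measurable_pi_apply _))

variable {B : Set (ℕ → ℝ)} {k : ℕ}

lemma measurable_walk_path : Measurable (walk : (ℕ → ℝ) → ℕ → ℝ) :=
  measurable_pi_lambda _ measurable_walk

/-- Since time `k` carries the minimum, S_k ≥ 0 already makes the whole past nonnegative, and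
staying above S_k later is a condition on the new steps only. -/
lemma splice_mem_stayNonneg_inter_iff
    (hdep : ∀ ζ ζ' : ℕ → ℝ, (∀ i ≤ k, ζ i = ζ' i) → (ζ ∈ B ↔ ζ' ∈ B))
    (hmin : ∀ ζ ∈ B, ∀ i, 1 ≤ i → i ≤ k → ζ k ≤ ζ i) (n : ℕ) (X X' : ℕ → ℝ) :
    (splice k X X' ∈ stayNonneg (k + n) ∧ walk (splice k X X') ∈ stayAbove B k n) ↔
      (walk X ∈ B ∧ 0 ≤ walk X k) ∧ X' ∈ stayNonneg n := by
  have h1 : walk (splice k X X') ∈ B ↔ walk X ∈ B := hdep _ _ fun i hi => walk_splice_of_le hi X X'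
  have hk : walk (splice k X X') k = walk X k := walk_splice_of_le le_rfl X X'
  constructor
  · rintro ⟨h2, h3, h4⟩
    refine ⟨⟨h1.1 h3, hk ▸ h2 k (Nat.le_add_right _ _)⟩, fun i hi => ?_⟩
    have := h4 i hi
    rw [hk, walk_splice_add] at this
    linarith
  · rintro ⟨⟨h2, h3⟩, h4⟩
    refine ⟨fun i hi => ?_, h1.2 h2, fun j hj => ?_⟩
    · rcases le_or_gt i k with hik | hik
      · rw [walk_splice_of_le hik]
        rcases Nat.eq_zero_or_pos i with rfl | hi0
        · simp
        · exact h3.trans (hmin _ h2 i hi0 hik)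
      · obtain ⟨j, rfl⟩ := Nat.exists_eq_add_of_le hik.le
        rw [walk_splice_add]
        exact add_nonneg h3 (h4 j (by omega))
    · rw [hk, walk_splice_add]
      linarith [h4 j hj]

/-- The `h`-transform formula at time `k + n`, split at time `k`: the integral over the later steps
is the one computed in `GoodEnv.lintegral_stayNonneg_harmonicU` with `y` = S_k. -/
lemma GoodEnv.harmonicU_mul_conditionedWalk_stayAbove (he : GoodEnv 𝓛 e) (hB : MeasurableSet B)
    (hdep : ∀ ζ ζ' : ℕ → ℝ, (∀ i ≤ k, ζ i = ζ' i) → (ζ ∈ B ↔ ζ' ∈ B))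
    (hmin : ∀ ζ ∈ B, ∀ i, 1 ≤ i → i ≤ k → ζ k ≤ ζ i) (n : ℕ) :
    harmonicU 𝓛 e 0 * conditionedWalk 𝓛 e (stayAbove B k n) =
      ∫⁻ X, {X | walk X ∈ B ∧ 0 ≤ walk X k}.indicator
        (fun X => lateExit 𝓛 (shift^[k] e) (walk X k) n + meanNonneg 𝓛 (shift^[k] e) n) X
        ∂(quenchedSteps 𝓛 e) := by
  have hA := measurableSet_stayAbove hB k n
  have hf : Measurable ((stayAbove B k n).indicator (1 : (ℕ → ℝ) → ℝ≥0∞)) :=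
    measurable_one.indicator hA
  have hfdep : DependsOn ((stayAbove B k n).indicator (1 : (ℕ → ℝ) → ℝ≥0∞))
      (Set.Iic (k + n)) := by
    intro ζ ζ' h
    have h1 : ζ ∈ stayAbove B k n ↔ ζ' ∈ stayAbove B k n := by
      refine and_congr (hdep _ _ fun i hi => h i (Set.mem_Iic.2 (by omega)))
        (forall₂_congr fun j hj => ?_)
      rw [h k (Set.mem_Iic.2 (by omega)), h (k + j) (Set.mem_Iic.2 (by omega))]
    by_cases hζ : ζ ∈ stayAbove B k n
    · rw [Set.indicator_of_mem hζ, Set.indicator_of_mem (h1.1 hζ)]; rfl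
    · rw [Set.indicator_of_notMem hζ, Set.indicator_of_notMem (mt h1.2 hζ)]
  rw [← lintegral_indicator_one hA, he.harmonicU_mul_lintegral_conditionedWalk (k + n) hf hfdep,
    lintegral_quenchedSteps_splice 𝓛 e k]
  · refine lintegral_congr fun X => ?_
    have hiter : shift^[k + n] e = shift^[n] (shift^[k] e) := by
      rw [add_comm, Function.iterate_add_apply]
    by_cases hX : walk X ∈ B ∧ 0 ≤ walk X k
    · rw [Set.indicator_of_mem (by exact hX),
        ← (he.iterate k).lintegral_stayNonneg_harmonicU hX.2 n]
      refine lintegral_congr fun X' => ?_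
      have hiff := splice_mem_stayNonneg_inter_iff hdep hmin n X X'
      by_cases hX' : X' ∈ stayNonneg n
      · obtain ⟨h1, h2⟩ := hiff.2 ⟨hX, hX'⟩
        rw [Set.indicator_of_mem h1, Set.indicator_of_mem h2, Set.indicator_of_mem hX',
          Pi.one_apply, one_mul, hiter, walk_splice_add]
      · rw [Set.indicator_of_notMem hX']
        by_cases h1 : splice k X X' ∈ stayNonneg (k + n)
        · rw [Set.indicator_of_mem h1, Set.indicator_of_notMem, zero_mul]
          exact fun h2 => hX' (hiff.1 ⟨h1, h2⟩).2
        · rw [Set.indicator_of_notMem h1]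
    · rw [Set.indicator_of_notMem (by exact hX)]
      refine (lintegral_congr fun X' => ?_).trans lintegral_zero
      have hiff := splice_mem_stayNonneg_inter_iff hdep hmin n X X'
      by_cases h1 : splice k X X' ∈ stayNonneg (k + n)
      · rw [Set.indicator_of_mem h1, Set.indicator_of_notMem, zero_mul]
        exact fun h2 => hX (hiff.1 ⟨h1, h2⟩).1
      · rw [Set.indicator_of_notMem h1]
  · exact ((hf.comp measurable_walk_path).mul ((measurable_harmonicU_right _).comp
      (measurable_walk _))).indicator (measurableSet_stayNonneg _)

/-- The probability that the conditioned walk follows a path which has its minimum at time `k`, and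
never falls below this minimum later. -/
lemma GoodEnv.harmonicU_mul_conditionedWalk_eq (he : GoodEnv 𝓛 e) (hB : MeasurableSet B)
    (hdep : ∀ ζ ζ' : ℕ → ℝ, (∀ i ≤ k, ζ i = ζ' i) → (ζ ∈ B ↔ ζ' ∈ B))
    (hmin : ∀ ζ ∈ B, ∀ i, 1 ≤ i → i ≤ k → ζ k ≤ ζ i) :
    harmonicU 𝓛 e 0 * conditionedWalk 𝓛 e {ζ | ζ ∈ B ∧ ∀ n, ζ k ≤ ζ (k + n)} =
      quenchedSteps 𝓛 e {X | walk X ∈ B ∧ 0 ≤ walk X k} * harmonicU 𝓛 (shift^[k] e) 0 := by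
  have hC : MeasurableSet {X : ℕ → ℝ | walk X ∈ B ∧ 0 ≤ walk X k} :=
    (measurable_walk_path hB).inter (measurableSet_le measurable_const (measurable_walk k))
  have hInter : {ζ : ℕ → ℝ | ζ ∈ B ∧ ∀ n, ζ k ≤ ζ (k + n)} = ⋂ n, stayAbove B k n := by
    ext ζ
    simp only [Set.mem_ofPred_eq, Set.mem_iInter, stayAbove]
    exact ⟨fun h n => ⟨h.1, fun j _ => h.2 j⟩, fun h => ⟨(h 0).1, fun n => (h n).2 n le_rfl⟩⟩
  have hlim1 : Filter.Tendsto (fun n => harmonicU 𝓛 e 0 * conditionedWalk 𝓛 e (stayAbove B k n))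
      Filter.atTop (nhds (harmonicU 𝓛 e 0 *
        conditionedWalk 𝓛 e {ζ | ζ ∈ B ∧ ∀ n, ζ k ≤ ζ (k + n)})) := by
    rw [hInter]
    refine ENNReal.Tendsto.const_mul ?_ (Or.inr (he.harmonicU_lt_top 0).ne)
    refine tendsto_measure_iInter_atTop
      (fun n => (measurableSet_stayAbove hB k n).nullMeasurableSet) ?_ ⟨0, measure_ne_top _ _⟩
    exact fun n n' hn ζ hζ => ⟨hζ.1, fun j hj => hζ.2 j (hj.trans hn)⟩
  have hlate : ∀ n, Measurable fun X : ℕ → ℝ => lateExit 𝓛 (shift^[k] e) (walk X k) n := by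
    intro n
    have h1 : Measurable fun y : ℝ => lateExit 𝓛 (shift^[k] e) y n := by
      unfold lateExit
      refine Measurable.lintegral_prod_right' (f := fun q : ℝ × (ℕ → ℝ) =>
        (stayNonneg n).indicator (negExit q.1) q.2) ?_
      have h2 : (fun q : ℝ × (ℕ → ℝ) => (stayNonneg n).indicator (negExit q.1) q.2) =
          (Prod.snd ⁻¹' stayNonneg n).indicator fun q => negExit q.1 q.2 := by
        ext q; rfl
      rw [h2]
      exact measurable_negExit.indicator (measurable_snd (measurableSet_stayNonneg n))
    exact h1.comp (measurable_walk k)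
  have hlim2 := tendsto_lintegral_of_dominated_convergence (μ := quenchedSteps 𝓛 e)
    (F := fun n => {X : ℕ → ℝ | walk X ∈ B ∧ 0 ≤ walk X k}.indicator
        fun X => lateExit 𝓛 (shift^[k] e) (walk X k) n + meanNonneg 𝓛 (shift^[k] e) n)
    (f := {X : ℕ → ℝ | walk X ∈ B ∧ 0 ≤ walk X k}.indicator
      fun _ => harmonicU 𝓛 (shift^[k] e) 0)
    -- Dominating function: `lateExit` is at most U(θᵏe, S_k), whose mean on `stayNonneg k` is U(e,
    -- 0), and `meanNonneg` is at most U(θᵏe, 0).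
    (fun X => (stayNonneg k).indicator (fun X => harmonicU 𝓛 (shift^[k] e) (walk X k)) X +
      harmonicU 𝓛 (shift^[k] e) 0)
    (fun n => ((hlate n).add measurable_const).indicator hC)
    (fun n => Filter.Eventually.of_forall fun X => by
      by_cases hX : walk X ∈ B ∧ 0 ≤ walk X k
      · have hX' : X ∈ stayNonneg k := fun i hi => by
          rcases Nat.eq_zero_or_pos i with rfl | hi0
          · simp
          · exact hX.2.trans (hmin _ hX.1 i hi0 hi)
        simp only [Set.indicator_of_mem hX',
          Set.indicator_of_mem (show X ∈ {X | walk X ∈ B ∧ 0 ≤ walk X k} from hX)]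
        refine add_le_add (lateExit_le _ _) ?_
        rw [← (he.iterate k).lateExit_add_meanNonneg n]
        exact le_add_self
      · rw [Set.indicator_of_notMem (by exact hX)]; exact bot_le)
    (by
      rw [lintegral_add_right _ measurable_const, he.lintegral_stayNonneg_harmonicU_zero,
        lintegral_const, measure_univ, mul_one]
      exact (ENNReal.add_lt_top.2
        ⟨he.harmonicU_lt_top 0, (he.iterate k).harmonicU_lt_top 0⟩).ne)
    (Filter.Eventually.of_forall fun X => by
      by_cases hX : walk X ∈ B ∧ 0 ≤ walk X k
      · simp only [Set.indicator_of_mem (show X ∈ {X | walk X ∈ B ∧ 0 ≤ walk X k} from hX)]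
        exact (he.iterate k).tendsto_lateExit_add_meanNonneg _
      · simp only [Set.indicator_of_notMem
          (show X ∉ {X | walk X ∈ B ∧ 0 ≤ walk X k} from hX)]
        exact tendsto_const_nhds)
  rw [lintegral_indicator_const hC, mul_comm] at hlim2
  exact tendsto_nhds_unique (hlim1.congr fun n =>
    he.harmonicU_mul_conditionedWalk_stayAbove hB hdep hmin n) hlim2

end RWRE
end

noncomputable section

namespace RWRE

/-! ### Excursions -/

/-- Separates the event into a condition on the path up to time `k` and a condition on its future,
as the factorisation requires. -/
lemma prospectiveMin_eq_coe_iff {ζ : ℕ → ℝ} {k : ℕ} :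
    prospectiveMin ζ = k ↔
      (1 ≤ k ∧ ∀ i, 1 ≤ i → i < k → ζ k < ζ i) ∧ ∀ n, ζ k ≤ ζ (k + n) := by
  rw [prospectiveMin, firstTime_eq_coe_iff]
  constructor
  · rintro ⟨⟨hk, hfut⟩, hlow⟩
    refine ⟨⟨hk, ?_⟩, hfut⟩
    -- Induction on the distance to `k`: since `i` is not a prospective minimum, some later value is
    -- strictly smaller. If it occurs at or after `k` it is at least ζ_k; if before, the induction
    -- hypothesis applies to it.
    suffices H : ∀ d i, k - i = d → 1 ≤ i → i < k → ζ k < ζ i from fun i => H _ i rfl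
    intro d
    induction d using Nat.strong_induction_on with
    | _ d ih =>
      intro i hd hi hik
      have h1 := hlow i hik
      push Not at h1
      obtain ⟨n, hn⟩ := h1 hi
      rcases le_or_gt k (i + n) with h2 | h2
      · have h3 := hfut (i + n - k)
        rw [Nat.add_sub_cancel' h2] at h3
        exact h3.trans_lt hn
      · have hn0 : n ≠ 0 := by rintro rfl; simp at hn
        exact (ih (k - (i + n)) (by omega) (i + n) rfl (by omega) h2).trans hn
  · rintro ⟨⟨hk, hlow⟩, hfut⟩
    refine ⟨⟨hk, hfut⟩, fun i hik h => ?_⟩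
    have h1 := h.2 (k - i)
    rw [Nat.add_sub_cancel' hik.le] at h1
    exact (hlow i h.1 hik).not_ge h1

lemma ladderEpoch_walk_eq_coe_iff {X : ℕ → ℝ} {k : ℕ} :
    ladderEpoch (walk X) = k ↔
      1 ≤ k ∧ 0 ≤ walk X k ∧ ∀ i, 1 ≤ i → i < k → walk X i < 0 := by
  rw [ladderEpoch, firstTime_eq_coe_iff, walk_zero, and_assoc]
  refine and_congr_right fun _ => and_congr_right fun _ => ?_
  simp only [not_and, not_le]
  exact ⟨fun h i hi hik => h i hik hi, fun h i hik hi => h i hi hik⟩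

/-- A sequence of length `k`, as a finite sequence. -/
def ofFin (k : ℕ) (v : Fin k → ℝ) : FinSeq := ⟨k, v⟩

/-- The paths whose values at times `1, …, k` lie in `A` and have their strict minimum at time
`k`. -/
def excursionSet (k : ℕ) (A : Set (Fin k → ℝ)) : Set (ℕ → ℝ) :=
  {ζ | (∀ i, 1 ≤ i → i < k → ζ k < ζ i) ∧ (fun j : Fin k => ζ (j + 1)) ∈ A}

lemma measurableSet_excursionSet (k : ℕ) {A : Set (Fin k → ℝ)} (hA : MeasurableSet A) :
    MeasurableSet (excursionSet k A) := by
  have h1 : excursionSet k A =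
      (⋂ (i : ℕ) (_ : 1 ≤ i) (_ : i < k), {ζ : ℕ → ℝ | ζ k < ζ i}) ∩
        (fun (ζ : ℕ → ℝ) (j : Fin k) => ζ (j + 1)) ⁻¹' A := by
    ext; simp [excursionSet]
  rw [h1]
  refine MeasurableSet.inter (MeasurableSet.iInter fun i => MeasurableSet.iInter fun _ =>
    MeasurableSet.iInter fun _ =>
      measurableSet_lt (measurable_pi_apply _) (measurable_pi_apply _)) ?_
  exact (measurable_pi_lambda _ fun j => measurable_pi_apply _) hA

lemma mem_excursionSet_congr {k : ℕ} (A : Set (Fin k → ℝ)) (ζ ζ' : ℕ → ℝ)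
    (h : ∀ i ≤ k, ζ i = ζ' i) : ζ ∈ excursionSet k A ↔ ζ' ∈ excursionSet k A := by
  refine and_congr (forall_congr' fun i => forall₂_congr fun _ hik => ?_) ?_
  · rw [h k le_rfl, h i hik.le]
  · have h1 : (fun j : Fin k => ζ (j + 1)) = fun j : Fin k => ζ' (j + 1) := by
      ext j; exact h _ j.2
    rw [h1]

lemma preMinExcursion_of_eq {ζ : ℕ → ℝ} {k : ℕ} (h : prospectiveMin ζ = k) :
    preMinExcursion ζ = ⟨k, fun j => ζ (j + 1)⟩ := by
  rw [preMinExcursion, h]; rfl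

lemma reversedLadderExcursion_of_eq {S : ℕ → ℝ} {k : ℕ} (h : ladderEpoch S = k) :
    reversedLadderExcursion S = ⟨k, fun j => S k - S (k - (j + 1))⟩ := by
  rw [reversedLadderExcursion, h]; rfl

lemma setOf_prospectiveMin_eq {k : ℕ} (hk : 1 ≤ k) (D : Set FinSeq) :
    {ζ | prospectiveMin ζ = k ∧ preMinExcursion ζ ∈ D} =
      {ζ | ζ ∈ excursionSet k (ofFin k ⁻¹' D) ∧ ∀ n, ζ k ≤ ζ (k + n)} := by
  ext ζ
  constructor
  · rintro ⟨h1, h2⟩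
    rw [preMinExcursion_of_eq h1] at h2
    obtain ⟨⟨-, h3⟩, h4⟩ := prospectiveMin_eq_coe_iff.1 h1
    exact ⟨⟨h3, h2⟩, h4⟩
  · rintro ⟨⟨h1, h2⟩, h3⟩
    have h4 := prospectiveMin_eq_coe_iff.2 ⟨⟨hk, h1⟩, h3⟩
    refine ⟨h4, ?_⟩
    rw [preMinExcursion_of_eq h4]
    exact h2

/-- The reversed walk has value S_k - S_{k-i} at time i, so having its strict minimum at time `k`
means S_{k-i} < 0 for 0 < i < k. -/
lemma setOf_ladderEpoch_eq {k : ℕ} (hk : 1 ≤ k) (D : Set FinSeq) :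
    {X | ladderEpoch (walk X) = k ∧ reversedLadderExcursion (walk X) ∈ D} =
      (fun (X : ℕ → ℝ) i => X (rev k i)) ⁻¹'
        {X | walk X ∈ excursionSet k (ofFin k ⁻¹' D) ∧ 0 ≤ walk X k} := by
  ext X
  have hw : ∀ i ≤ k, walk (fun i => X (rev k i)) i = walk X k - walk X (k - i) :=
    fun i hi => walk_rev hi X
  have hwk : walk (fun i => X (rev k i)) k = walk X k := by rw [hw k le_rfl]; simp
  have hfun : (fun j : Fin k => walk (fun i => X (rev k i)) (j + 1)) =
      fun j : Fin k => walk X k - walk X (k - (j + 1)) := by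
    ext j; exact hw _ j.2
  simp only [Set.mem_preimage, Set.mem_ofPred_eq, excursionSet, hfun, hwk]
  constructor
  · rintro ⟨h1, h2⟩
    rw [reversedLadderExcursion_of_eq h1] at h2
    obtain ⟨-, h3, h4⟩ := ladderEpoch_walk_eq_coe_iff.1 h1
    refine ⟨⟨fun i hi hik => ?_, h2⟩, h3⟩
    rw [hw i hik.le]
    linarith [h4 (k - i) (by omega) (by omega)]
  · rintro ⟨⟨h1, h2⟩, h3⟩
    have h4 : ladderEpoch (walk X) = k := by
      refine ladderEpoch_walk_eq_coe_iff.2 ⟨hk, h3, fun i hi hik => ?_⟩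
      have h5 := h1 (k - i) (by omega) (by omega)
      rw [hw _ (by omega), Nat.sub_sub_self hik.le] at h5
      linarith
    refine ⟨h4, ?_⟩
    rw [reversedLadderExcursion_of_eq h4]
    exact h2

lemma measurable_ofFin_preimage {D : Set FinSeq} (hD : MeasurableSet D) (k : ℕ) :
    MeasurableSet (ofFin k ⁻¹' D) :=
  MeasurableSpace.measurableSet_iInf.1 hD k

/-- On each event where the length is fixed, the map takes values in a single component of the
disjoint union. -/
lemma measurable_finSeq_mk {α : Type*} [MeasurableSpace α] {N : α → ℕ} (hN : Measurable N)
    {g : α → ℕ → ℕ → ℝ} (hg : ∀ k j, Measurable fun a => g a k j) :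
    Measurable fun a => (⟨N a, fun j => g a (N a) j⟩ : FinSeq) := by
  intro D hD
  have h1 : (fun a => (⟨N a, fun j => g a (N a) j⟩ : FinSeq)) ⁻¹' D =
      ⋃ k : ℕ, (N ⁻¹' {k}) ∩ (fun a (j : Fin k) => g a k j) ⁻¹' (ofFin k ⁻¹' D) := by
    ext a
    simp only [Set.mem_preimage, Set.mem_iUnion, Set.mem_inter_iff, Set.mem_singleton_iff]
    constructor
    · exact fun h => ⟨N a, rfl, h⟩
    · rintro ⟨k, rfl, h⟩
      exact h
  rw [h1]
  refine MeasurableSet.iUnion fun k => (hN (measurableSet_singleton k)).inter ?_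
  have h2 : Measurable fun a (j : Fin k) => g a k j := measurable_pi_lambda _ fun j => hg k j
  exact h2 (measurable_ofFin_preimage hD k)

lemma measurable_prospectiveMin : Measurable prospectiveMin := by
  refine measurable_firstTime fun m => ?_
  have h1 : {ζ : ℕ → ℝ | ∀ n, ζ m ≤ ζ (m + n)} = ⋂ n, {ζ : ℕ → ℝ | ζ m ≤ ζ (m + n)} := by
    ext; simp
  have h2 : MeasurableSet {ζ : ℕ → ℝ | ∀ n, ζ m ≤ ζ (m + n)} := by
    rw [h1]
    exact MeasurableSet.iInter fun n =>
      measurableSet_le (measurable_pi_apply _) (measurable_pi_apply _)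
  exact (MeasurableSet.const _).inter h2

lemma measurable_ladderEpoch : Measurable ladderEpoch := by
  refine measurable_firstTime fun m => ?_
  exact (MeasurableSet.const _).inter
    (measurableSet_le (measurable_pi_apply _) (measurable_pi_apply _))

lemma measurable_preMinExcursion : Measurable preMinExcursion :=
  measurable_finSeq_mk ((measurable_from_top (f := ENat.toNat)).comp measurable_prospectiveMin)
    (g := fun ζ _ j => ζ (j + 1)) fun _ _ => measurable_pi_apply _

lemma measurable_reversedLadderExcursion : Measurable reversedLadderExcursion :=
  measurable_finSeq_mk ((measurable_from_top (f := ENat.toNat)).comp measurable_ladderEpoch)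
    (g := fun S k j => S k - S (k - (j + 1)))
    fun _ _ => (measurable_pi_apply _).sub (measurable_pi_apply _)

/-- The last entry of a finite sequence, `0` for the empty one. -/
def lastEntry : FinSeq → ℝ
  | ⟨0, _⟩ => 0
  | ⟨n + 1, v⟩ => v (Fin.last n)

lemma measurable_lastEntry : Measurable lastEntry := by
  intro B hB
  refine MeasurableSpace.measurableSet_iInf.2 fun k => ?_
  have h : Measurable fun v : Fin k → ℝ => lastEntry ⟨k, v⟩ := by
    cases k with
    | zero => exact measurable_const
    | succ n => exact measurable_pi_apply _
  exact h hB

lemma lastEntry_preMinExcursion {ζ : ℕ → ℝ} (h : prospectiveMin ζ < ⊤) :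
    lastEntry (preMinExcursion ζ) = ζ (prospectiveMin ζ).toNat := by
  obtain ⟨k, hk⟩ := ENat.ne_top_iff_exists.1 h.ne
  obtain ⟨n, rfl⟩ := Nat.exists_eq_add_of_le' (prospectiveMin_eq_coe_iff.1 hk.symm).1.1
  rw [preMinExcursion_of_eq hk.symm, ← hk]
  rfl

lemma lastEntry_reversedLadderExcursion {X : ℕ → ℝ} (h : ladderEpoch (walk X) < ⊤) :
    lastEntry (reversedLadderExcursion (walk X)) =
      walk X (ladderEpoch (walk X)).toNat := by
  obtain ⟨k, hk⟩ := ENat.ne_top_iff_exists.1 h.ne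
  obtain ⟨n, rfl⟩ := Nat.exists_eq_add_of_le' (ladderEpoch_walk_eq_coe_iff.1 hk.symm).1
  rw [reversedLadderExcursion_of_eq hk.symm, ← hk]
  change walk X (n + 1) - walk X (n + 1 - (n + 1)) = walk X (n + 1)
  simp

end RWRE
end

noncomputable section

namespace RWRE
variable {E : Type*} [MeasurableSpace E]

/-! ### The annealed walk -/

section Annealed

variable (η : Measure E) (𝓛 : Kernel E (Measure ℝ))

/-- The law of a step of the annealed walk, when `η` is the law of the environment at one time. -/
def annealedLaw : Measure ℝ := η.bind (stepLaw 𝓛)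

instance [IsProbabilityMeasure η] : IsProbabilityMeasure (annealedLaw η 𝓛) := by
  unfold annealedLaw; infer_instance

lemma lintegral_annealedLaw {f : ℝ → ℝ≥0∞} (hf : Measurable f) :
    ∫⁻ x, f x ∂(annealedLaw η 𝓛) = ∫⁻ a, ∫⁻ x, f x ∂(stepLaw 𝓛 a) ∂η :=
  Measure.lintegral_bind (stepLaw 𝓛).aemeasurable hf.aemeasurable

variable [IsProbabilityMeasure η]

/-- Averaging the quenched law of the steps over an i.i.d. environment makes the steps i.i.d. -/
lemma bind_quenchedSteps :
    (Measure.infinitePi fun _ : ℕ => η).bind (quenchedSteps 𝓛) =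
      Measure.infinitePi fun _ : ℕ => annealedLaw η 𝓛 := by
  refine Measure.eq_infinitePi _ fun s t ht => ?_
  rw [Measure.bind_apply (.pi s.countable_toSet fun i _ => ht i) (quenchedSteps 𝓛).aemeasurable]
  have h1 : ∀ e : ℕ → E, quenchedSteps 𝓛 e (Set.pi s t) = ∏ i ∈ s, stepLaw 𝓛 (e i) (t i) :=
    fun e => Measure.infinitePi_pi _ fun i _ => ht i
  have hm : ∀ i, Measurable fun a => stepLaw 𝓛 a (t i) := fun i =>
    (stepLaw 𝓛).measurable_coe (ht i)
  simp only [h1]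
  rw [lintegral_prod_eq_prod_lintegral_of_indepFun s (fun i (e : ℕ → E) => stepLaw 𝓛 (e i) (t i))
    (iIndepFun_infinitePi (X := fun i a => stepLaw 𝓛 a (t i)) hm)
    fun i => (hm i).comp (measurable_pi_apply i)]
  refine Finset.prod_congr rfl fun i _ => ?_
  rw [lintegral_infinitePi_eval (fun _ : ℕ => η) i (hm i), annealedLaw,
    Measure.bind_apply (ht i) (stepLaw 𝓛).aemeasurable]

lemma lintegral_quenchedSteps {f : (ℕ → ℝ) → ℝ≥0∞} (hf : Measurable f) :
    ∫⁻ e, ∫⁻ X, f X ∂(quenchedSteps 𝓛 e) ∂(Measure.infinitePi fun _ : ℕ => η) =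
      ∫⁻ X, f X ∂(Measure.infinitePi fun _ : ℕ => annealedLaw η 𝓛) := by
  rw [← bind_quenchedSteps,
    Measure.lintegral_bind (quenchedSteps 𝓛).aemeasurable hf.aemeasurable]

lemma lintegral_harmonicU (y : ℝ) :
    ∫⁻ e, harmonicU 𝓛 e y ∂(Measure.infinitePi fun _ : ℕ => η) =
      ∫⁻ X, negExit y X ∂(Measure.infinitePi fun _ : ℕ => annealedLaw η 𝓛) :=
  lintegral_quenchedSteps η 𝓛 (measurable_negExit_right y)

/-- The assumptions on the law of the environment: the steps are centred, have a finite second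
moment, and are not degenerate. -/
structure CentredEnv (η : Measure E) (𝓛 : Kernel E (Measure ℝ)) : Prop where
  mean_eq : ∀ᵐ a ∂η, ∫⁻ x, ENNReal.ofReal x ∂(stepLaw 𝓛 a) =
    ∫⁻ x, ENNReal.ofReal (-x) ∂(stepLaw 𝓛 a)
  pos : ∀ᵐ a ∂η, 0 < stepLaw 𝓛 a (Set.Ioi 0)
  sq_lt_top : ∫⁻ x, ENNReal.ofReal (x ^ 2) ∂(annealedLaw η 𝓛) < ∞

variable {η 𝓛}

lemma CentredEnv.annealedLaw_pos (h : CentredEnv η 𝓛) : 0 < annealedLaw η 𝓛 (Set.Ioi 0) := by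
  rw [annealedLaw, Measure.bind_apply measurableSet_Ioi (stepLaw 𝓛).aemeasurable,
    pos_iff_ne_zero]
  intro h0
  rw [lintegral_eq_zero_iff ((stepLaw 𝓛).measurable_coe measurableSet_Ioi)] at h0
  obtain ⟨a, h1, h2⟩ := (h0.and h.pos).exists
  exact h2.ne' h1

lemma CentredEnv.integrable (h : CentredEnv η 𝓛) : Integrable id (annealedLaw η 𝓛) := by
  refine ⟨aestronglyMeasurable_id, ?_⟩
  refine lt_of_le_of_lt (lintegral_mono (g := fun x => 1 + ENNReal.ofReal (x ^ 2)) fun x => ?_) ?_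
  · beta_reduce
    rw [← ofReal_norm, ← ENNReal.ofReal_one, ← ENNReal.ofReal_add zero_le_one (sq_nonneg x)]
    refine ENNReal.ofReal_le_ofReal ?_
    rw [id, Real.norm_eq_abs]
    nlinarith [sq_abs x, sq_nonneg (|x| - 1)]
  · rw [lintegral_add_left measurable_const, lintegral_const, measure_univ]
    simpa using h.sq_lt_top

lemma CentredEnv.lintegral_ofReal_lt_top (h : CentredEnv η 𝓛) :
    ∫⁻ x, ENNReal.ofReal x ∂(annealedLaw η 𝓛) < ∞ :=
  h.integrable.lintegral_lt_top

lemma CentredEnv.integral_eq_zero (h : CentredEnv η 𝓛) : ∫ x, x ∂(annealedLaw η 𝓛) = 0 := by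
  have hint : Integrable (fun x => x) (annealedLaw η 𝓛) := h.integrable
  rw [integral_eq_lintegral_pos_part_sub_lintegral_neg_part hint,
    lintegral_annealedLaw η 𝓛 ENNReal.measurable_ofReal,
    lintegral_annealedLaw η 𝓛 (f := fun x => ENNReal.ofReal (-x)) (by fun_prop), sub_eq_zero]
  exact congrArg _ (lintegral_congr_ae h.mean_eq)

lemma CentredEnv.ae_tau_lt_top (h : CentredEnv η 𝓛) :
    ∀ᵐ X ∂(Measure.infinitePi fun _ : ℕ => annealedLaw η 𝓛), ∀ y, tau y X < ⊤ :=
  ae_forall_tau_lt_top _ h.annealedLaw_pos <|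
    ae_tau_zero_lt_top _ h.integrable h.integral_eq_zero
      (lintegral_negExit_zero_lt_top _ h.sq_lt_top h.annealedLaw_pos) h.annealedLaw_pos

lemma CentredEnv.lintegral_negExit_lt_top (h : CentredEnv η 𝓛) (y : ℝ) :
    ∫⁻ X, negExit y X ∂(Measure.infinitePi fun _ : ℕ => annealedLaw η 𝓛) < ∞ :=
  RWRE.lintegral_negExit_lt_top _ h.sq_lt_top h.annealedLaw_pos h.lintegral_ofReal_lt_top
    h.ae_tau_lt_top y

lemma CentredEnv.lintegral_harmonicU_pos (h : CentredEnv η 𝓛) :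
    0 < ∫⁻ e, harmonicU 𝓛 e 0 ∂(Measure.infinitePi fun _ : ℕ => η) := by
  rw [lintegral_harmonicU, pos_iff_ne_zero]
  intro h0
  rw [lintegral_eq_zero_iff (measurable_negExit_right 0)] at h0
  obtain ⟨X, h1, h2⟩ := (h0.and h.ae_tau_lt_top).exists
  exact (negExit_pos le_rfl (h2 0)).ne' h1

lemma CentredEnv.lintegral_harmonicU_lt_top (h : CentredEnv η 𝓛) :
    ∫⁻ e, harmonicU 𝓛 e 0 ∂(Measure.infinitePi fun _ : ℕ => η) < ∞ := by
  rw [lintegral_harmonicU]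
  exact h.lintegral_negExit_lt_top 0

/-- Annealed almost sure and integrability statements pass to almost every environment by Fubini.
Coordinates and shifts are measure preserving, which gives all `n` at once; finiteness of U at
integer levels extends to every level by monotonicity. -/
lemma CentredEnv.ae_goodEnv (h : CentredEnv η 𝓛) : ∀ᵐ e ∂(Measure.infinitePi fun _ : ℕ => η), GoodEnv 𝓛 e := by
  have heval : ∀ {p : E → Prop}, (∀ᵐ a ∂η, p a) →
      ∀ᵐ e ∂(Measure.infinitePi fun _ : ℕ => η), ∀ n, p (e n) := fun {p} hp =>
    ae_all_iff.2 fun n =>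
      (measurePreserving_eval_infinitePi (fun _ : ℕ => η) n).quasiMeasurePreserving.ae hp
  have hshift : ∀ {p : (ℕ → E) → Prop}, (∀ᵐ e ∂(Measure.infinitePi fun _ : ℕ => η), p e) →
      ∀ᵐ e ∂(Measure.infinitePi fun _ : ℕ => η), ∀ n, p (shift^[n] e) := by
    have hs : Measure.map shift (Measure.infinitePi fun _ : ℕ => η) =
        Measure.infinitePi fun _ : ℕ => η :=
      Measure.map_infinitePi_infinitePi_of_inj (P := fun _ : ℕ => η) (f := fun n : ℕ => n + 1)
        (add_left_injective 1)
    have hmp : MeasurePreserving shift (Measure.infinitePi fun _ : ℕ => η)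
      (Measure.infinitePi fun _ : ℕ => η) := ⟨measurable_shift, hs⟩
    exact fun {p} hp => ae_all_iff.2 fun n => (hmp.iterate n).quasiMeasurePreserving.ae hp
  have hfin : ∀ᵐ a ∂η, ∫⁻ x, ENNReal.ofReal x ∂(stepLaw 𝓛 a) < ∞ := by
    have h1 := h.lintegral_ofReal_lt_top
    rw [lintegral_annealedLaw η 𝓛 ENNReal.measurable_ofReal] at h1
    exact ae_lt_top (ENNReal.measurable_ofReal.lintegral_kernel) h1.ne
  have htau : ∀ᵐ e ∂(Measure.infinitePi fun _ : ℕ => η),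
      ∀ᵐ X ∂(quenchedSteps 𝓛 e), ∀ y, tau y X < ⊤ := by
    refine Measure.ae_ae_of_ae_bind (quenchedSteps 𝓛).aemeasurable ?_
    rw [bind_quenchedSteps]
    exact h.ae_tau_lt_top
  have hU : ∀ᵐ e ∂(Measure.infinitePi fun _ : ℕ => η), ∀ k : ℕ, harmonicU 𝓛 e k < ∞ := by
    refine ae_all_iff.2 fun k => ae_lt_top ?_ ?_
    · exact (measurable_negExit_right (k : ℝ)).lintegral_kernel
    · rw [lintegral_harmonicU]
      exact (h.lintegral_negExit_lt_top k).ne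
  filter_upwards [heval h.mean_eq, heval hfin, hshift htau, hshift hU] with e h1 h2 h3 h4
  refine ⟨h1, h2, h3, fun n y => ?_⟩
  obtain ⟨k, hk⟩ := exists_nat_ge y
  refine lt_of_le_of_lt (lintegral_mono_ae ?_) (h4 n k)
  filter_upwards [h3 n] with X hX
  exact negExit_mono hk (hX _)

/-- The annealed law of the pre-minimum excursion, on the event that it has length `k`. -/
lemma CentredEnv.lintegral_harmonicU_mul_conditionedWalk (h : CentredEnv η 𝓛) {k : ℕ} (hk : 1 ≤ k) {D : Set FinSeq}
    (hD : MeasurableSet D) :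
    ∫⁻ e, harmonicU 𝓛 e 0 *
        conditionedWalk 𝓛 e {ζ | prospectiveMin ζ = k ∧ preMinExcursion ζ ∈ D}
        ∂(Measure.infinitePi fun _ : ℕ => η) =
      Measure.infinitePi (fun _ : ℕ => annealedLaw η 𝓛)
        {X | ladderEpoch (walk X) = k ∧ reversedLadderExcursion (walk X) ∈ D} *
        ∫⁻ e, harmonicU 𝓛 e 0 ∂(Measure.infinitePi fun _ : ℕ => η) := by
  set B := excursionSet k (ofFin k ⁻¹' D) with hBdef
  have hB : MeasurableSet B := measurableSet_excursionSet k (measurable_ofFin_preimage hD k)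
  set C : Set (ℕ → ℝ) := {X | walk X ∈ B ∧ 0 ≤ walk X k} with hCdef
  have hC : MeasurableSet C :=
    (measurable_walk_path hB).inter (measurableSet_le measurable_const (measurable_walk k))
  have hCs : ∀ X X', splice k X X' ∈ C ↔ X ∈ C := by
    intro X X'
    refine and_congr (mem_excursionSet_congr _ _ _ fun i hi => walk_splice_of_le hi X X') ?_
    rw [walk_splice_of_le le_rfl]
  have htail : Measurable fun (X : ℕ → ℝ) => negExit 0 fun i => X (i + k) := by
    have h1 : Measurable fun (X : ℕ → ℝ) (i : ℕ) => X (i + k) :=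
      measurable_pi_lambda _ fun i => measurable_pi_apply _
    exact (measurable_negExit_right 0).comp h1
  have hf : Measurable fun X : ℕ → ℝ =>
      C.indicator (1 : (ℕ → ℝ) → ℝ≥0∞) X * negExit 0 fun i => X (i + k) :=
    (measurable_one.indicator hC).mul htail
  have hfs : ∀ X X', C.indicator (1 : (ℕ → ℝ) → ℝ≥0∞) (splice k X X') *
      negExit 0 (fun i => splice k X X' (i + k)) = C.indicator 1 X * negExit 0 X' := by
    intro X X'
    have h1 : (fun i => splice k X X' (i + k)) = X' := by ext i; simp [splice]
    rw [h1]
    by_cases hX : X ∈ C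
    · simp [hX, (hCs X X').2 hX]
    · simp [hX, mt (hCs X X').1 hX]
  -- The product is written as one quenched expectation, with U(θᵏe, 0) the mean exit position of
  -- the steps after `k`, so that the environment can be averaged out.
  have hquenched : ∀ e, quenchedSteps 𝓛 e C * harmonicU 𝓛 (shift^[k] e) 0 =
      ∫⁻ X, C.indicator 1 X * negExit 0 (fun i => X (i + k)) ∂(quenchedSteps 𝓛 e) := by
    intro e
    rw [lintegral_quenchedSteps_splice 𝓛 e k hf]
    simp only [hfs]
    simp only [lintegral_const_mul _ (measurable_negExit_right 0)]
    rw [lintegral_mul_const _ (measurable_one.indicator hC), lintegral_indicator_one hC]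
    rfl
  rw [setOf_prospectiveMin_eq hk, setOf_ladderEpoch_eq hk]
  have h1 : ∀ᵐ e ∂(Measure.infinitePi fun _ : ℕ => η), harmonicU 𝓛 e 0 *
      conditionedWalk 𝓛 e {ζ | ζ ∈ B ∧ ∀ n, ζ k ≤ ζ (k + n)} =
        ∫⁻ X, C.indicator 1 X * negExit 0 (fun i => X (i + k)) ∂(quenchedSteps 𝓛 e) := by
    filter_upwards [h.ae_goodEnv] with e he
    rw [he.harmonicU_mul_conditionedWalk_eq hB (mem_excursionSet_congr _) ?_]
    · exact hquenched e
    · intro ζ hζ i hi hik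
      rcases hik.eq_or_lt with rfl | hlt
      · exact le_rfl
      · exact (hζ.1 i hi hlt).le
  -- After averaging, the steps are i.i.d.; splitting at `k` makes the event `C` and the later exit
  -- position independent, and the mean of the latter is U(0).
  rw [lintegral_congr_ae h1, lintegral_quenchedSteps η 𝓛 hf,
    lintegral_infinitePi_splice (fun _ : ℕ => annealedLaw η 𝓛) k hf]
  simp only [hfs]
  simp only [lintegral_const_mul _ (measurable_negExit_right 0)]
  rw [lintegral_mul_const _ (measurable_one.indicator hC), lintegral_indicator_one hC,
    lintegral_harmonicU, ← Measure.map_apply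
      (measurable_pi_lambda _ fun i => measurable_pi_apply _) hC, map_rev_infinitePi]

end Annealed

end RWRE
end

noncomputable section

namespace RWRE
variable {E : Type*} [MeasurableSpace E]

/-! ### From point processes to step laws -/

lemma lintegral_weighted (L : Measure ℝ) {f : ℝ → ℝ≥0∞} (hf : Measurable f) :
    ∫⁻ x, f x ∂(weighted L) = ∫⁻ x, ENNReal.ofReal (Real.exp (-x)) * f x ∂L :=
  lintegral_withDensity_eq_lintegral_mul L (by fun_prop) hf

lemma lintegral_tiltedIntensity (𝓛 : Kernel E (Measure ℝ)) (a : E) {f : ℝ → ℝ≥0∞}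
    (hf : Measurable f) :
    ∫⁻ x, f x ∂(tiltedIntensity 𝓛 a) = ∫⁻ L, ∫⁻ x, f x ∂(weighted L) ∂(𝓛 a) :=
  Kernel.lintegral_comp _ _ _ hf

/-- The normalisation makes the tilted intensity a probability measure, so the default value in
`probPart` does not occur. -/
lemma stepLaw_eq_of_mass {𝓛 : Kernel E (Measure ℝ)} {a : E}
    (h : ∫⁻ L, ∫⁻ x, ENNReal.ofReal (Real.exp (-x)) ∂L ∂(𝓛 a) = 1) :
    stepLaw 𝓛 a = tiltedIntensity 𝓛 a := by
  have h1 : tiltedIntensity 𝓛 a Set.univ = 1 := by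
    refine lintegral_one.symm.trans ?_
    rw [lintegral_tiltedIntensity 𝓛 a measurable_const]
    refine Eq.trans (lintegral_congr fun L => ?_) h
    rw [lintegral_weighted L measurable_const]
    exact lintegral_congr fun x => mul_one _
  rw [stepLaw, probPart, Kernel.piecewise_apply, if_pos (by exact h1)]

lemma stepLaw_Ioi {𝓛 : Kernel E (Measure ℝ)} {a : E}
    (h : ∫⁻ L, ∫⁻ x, ENNReal.ofReal (Real.exp (-x)) ∂L ∂(𝓛 a) = 1) :
    stepLaw 𝓛 a (Set.Ioi 0) =
      ∫⁻ L, ∫⁻ x in Set.Ioi 0, ENNReal.ofReal (Real.exp (-x)) ∂L ∂(𝓛 a) := by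
  rw [stepLaw_eq_of_mass h, ← lintegral_indicator_one measurableSet_Ioi,
    lintegral_tiltedIntensity 𝓛 a (measurable_one.indicator measurableSet_Ioi)]
  refine lintegral_congr fun L => ?_
  rw [lintegral_indicator_one measurableSet_Ioi]
  exact withDensity_apply _ measurableSet_Ioi

lemma sq_le_one_add_rpow {δ : ℝ} (hδ : 0 < δ) (x : ℝ) : x ^ 2 ≤ 1 + |x| ^ (2 + δ) := by
  have h0 : 0 ≤ |x| ^ (2 + δ) := by positivity
  rw [← sq_abs]
  rcases le_total |x| 1 with h | h
  · nlinarith [abs_nonneg x]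
  · have h1 : |x| ^ (2 : ℝ) ≤ |x| ^ (2 + δ) :=
      Real.rpow_le_rpow_of_exponent_le h (by linarith)
    rw [Real.rpow_two] at h1
    linarith

lemma lintegral_sq_stepLaw_le {𝓛 : Kernel E (Measure ℝ)} {a : E} {δ : ℝ} (hδ : 0 < δ)
    (h : ∫⁻ L, ∫⁻ x, ENNReal.ofReal (Real.exp (-x)) ∂L ∂(𝓛 a) = 1) :
    ∫⁻ x, ENNReal.ofReal (x ^ 2) ∂(stepLaw 𝓛 a) ≤
      1 + ∫⁻ L, ∫⁻ x, ENNReal.ofReal (|x| ^ (2 + δ) * Real.exp (-x)) ∂L ∂(𝓛 a) := by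
  have hm : Measurable fun x : ℝ => ENNReal.ofReal (|x| ^ (2 + δ)) := by fun_prop
  have h1 : ∫⁻ L, ∫⁻ x, ENNReal.ofReal (|x| ^ (2 + δ) * Real.exp (-x)) ∂L ∂(𝓛 a) =
      ∫⁻ x, ENNReal.ofReal (|x| ^ (2 + δ)) ∂(stepLaw 𝓛 a) := by
    rw [stepLaw_eq_of_mass h, lintegral_tiltedIntensity 𝓛 a hm]
    refine lintegral_congr fun L => ?_
    rw [lintegral_weighted L hm]
    refine lintegral_congr fun x => ?_
    rw [mul_comm, ENNReal.ofReal_mul (Real.exp_pos _).le]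
  rw [h1]
  calc ∫⁻ x, ENNReal.ofReal (x ^ 2) ∂(stepLaw 𝓛 a)
      ≤ ∫⁻ x, (1 + ENNReal.ofReal (|x| ^ (2 + δ))) ∂(stepLaw 𝓛 a) := by
        refine lintegral_mono fun x => ?_
        beta_reduce
        rw [← ENNReal.ofReal_one, ← ENNReal.ofReal_add zero_le_one (by positivity)]
        exact ENNReal.ofReal_le_ofReal (sq_le_one_add_rpow hδ x)
    _ = _ := by rw [lintegral_add_left measurable_const, lintegral_const, measure_univ, one_mul]

lemma integral_mul_exp_neg {L : Measure ℝ}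
    (hp : ∫⁻ x, ENNReal.ofReal x ∂(weighted L) < ∞)
    (hn : ∫⁻ x, ENNReal.ofReal (-x) ∂(weighted L) < ∞) :
    ∫ x, x * Real.exp (-x) ∂L = (∫⁻ x, ENNReal.ofReal x ∂(weighted L)).toReal -
      (∫⁻ x, ENNReal.ofReal (-x) ∂(weighted L)).toReal := by
  have hint : Integrable (fun x : ℝ => x) (weighted L) := by
    refine ⟨aestronglyMeasurable_id, ?_⟩
    have h1 : ∀ x : ℝ, ‖x‖ₑ = ENNReal.ofReal x + ENNReal.ofReal (-x) := by
      intro x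
      rw [← ofReal_norm, Real.norm_eq_abs]
      rcases le_total 0 x with h | h
      · rw [abs_of_nonneg h, ENNReal.ofReal_of_nonpos (p := -x) (by linarith), add_zero]
      · rw [abs_of_nonpos h, ENNReal.ofReal_of_nonpos h, zero_add]
    simp only [HasFiniteIntegral, h1]
    rw [lintegral_add_left ENNReal.measurable_ofReal]
    exact ENNReal.add_lt_top.2 ⟨hp, hn⟩
  rw [← integral_eq_lintegral_pos_part_sub_lintegral_neg_part hint]
  have h2 : weighted L = L.withDensity fun x => ENNReal.ofReal (Real.exp (-x)) := rfl
  rw [h2, integral_withDensity_eq_integral_toReal_smul (by fun_prop)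
    (Filter.Eventually.of_forall fun _ => ENNReal.ofReal_lt_top)]
  refine integral_congr_ae (Filter.Eventually.of_forall fun x => ?_)
  simp only [ENNReal.toReal_ofReal (Real.exp_pos _).le, smul_eq_mul, mul_comm]

/-- A Bochner integral may vanish by default for lack of integrability. The finite second moment
makes both parts of the step integrable, so `hmean` really expresses centring. -/
lemma lintegral_stepLaw_eq_neg {𝓛 : Kernel E (Measure ℝ)} {a : E}
    (h : ∫⁻ L, ∫⁻ x, ENNReal.ofReal (Real.exp (-x)) ∂L ∂(𝓛 a) = 1)
    (hsq : ∫⁻ x, ENNReal.ofReal (x ^ 2) ∂(stepLaw 𝓛 a) < ∞)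
    (hmean : ∫ L, ∫ x, x * Real.exp (-x) ∂L ∂(𝓛 a) = 0) :
    ∫⁻ x, ENNReal.ofReal x ∂(stepLaw 𝓛 a) = ∫⁻ x, ENNReal.ofReal (-x) ∂(stepLaw 𝓛 a) := by
  have hn : Measurable fun x : ℝ => ENNReal.ofReal (-x) := by fun_prop
  have hfin : ∀ f : ℝ → ℝ, (∀ x, f x ≤ 1 + x ^ 2) →
      ∫⁻ x, ENNReal.ofReal (f x) ∂(stepLaw 𝓛 a) < ∞ := by
    intro f hf
    refine lt_of_le_of_lt (lintegral_mono (g := fun x => 1 + ENNReal.ofReal (x ^ 2))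
      fun x => ?_) ?_
    · beta_reduce
      rw [← ENNReal.ofReal_one, ← ENNReal.ofReal_add zero_le_one (sq_nonneg x)]
      exact ENNReal.ofReal_le_ofReal (hf x)
    · rw [lintegral_add_left measurable_const, lintegral_const, measure_univ]
      simpa using hsq
  have hp1 := hfin (fun x => x) fun x => by nlinarith [sq_nonneg (x - 1)]
  have hn1 := hfin (fun x => -x) fun x => by nlinarith [sq_nonneg (x + 1)]
  rw [stepLaw_eq_of_mass h, lintegral_tiltedIntensity 𝓛 a ENNReal.measurable_ofReal] at hp1 ⊢
  rw [stepLaw_eq_of_mass h, lintegral_tiltedIntensity 𝓛 a hn] at hn1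
  rw [lintegral_tiltedIntensity 𝓛 a hn]
  have hpm : Measurable fun L : Measure ℝ => ∫⁻ x, ENNReal.ofReal x ∂(weighted L) :=
    ENNReal.measurable_ofReal.lintegral_kernel
  have hnm : Measurable fun L : Measure ℝ => ∫⁻ x, ENNReal.ofReal (-x) ∂(weighted L) :=
    hn.lintegral_kernel
  have hpa := ae_lt_top hpm hp1.ne
  have hna := ae_lt_top hnm hn1.ne
  have h1 : ∀ᵐ L ∂(𝓛 a), ∫ x, x * Real.exp (-x) ∂L =
      (∫⁻ x, ENNReal.ofReal x ∂(weighted L)).toReal -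
        (∫⁻ x, ENNReal.ofReal (-x) ∂(weighted L)).toReal := by
    filter_upwards [hpa, hna] with L h2 h3
    exact integral_mul_exp_neg h2 h3
  rw [integral_congr_ae h1, integral_sub
    (integrable_toReal_of_lintegral_ne_top hpm.aemeasurable hp1.ne)
    (integrable_toReal_of_lintegral_ne_top hnm.aemeasurable hn1.ne),
    integral_toReal hpm.aemeasurable hpa, integral_toReal hnm.aemeasurable hna,
    sub_eq_zero] at hmean
  exact (ENNReal.toReal_eq_toReal_iff' hp1.ne hn1.ne).1 hmean

/-! ### The law of the environment and the conclusion -/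

lemma measurableSet_setOf_lt_top {α : Type*} [MeasurableSpace α] {N : α → ℕ∞}
    (hN : Measurable N) : MeasurableSet {a | N a < ⊤} := by
  have h : {a | N a < ⊤} = (N ⁻¹' {⊤})ᶜ := by ext; simp [lt_top_iff_ne_top]
  rw [h]
  exact (hN (measurableSet_singleton _)).compl

lemma measure_lt_top_and_mem {α γ : Type*} [MeasurableSpace α] [MeasurableSpace γ]
    (μ : Measure α) {N : α → ℕ∞} {X : α → γ} (hN : Measurable N) (hX : Measurable X)
    {D : Set γ} (hD : MeasurableSet D) :
    μ {a | N a < ⊤ ∧ X a ∈ D} = ∑' k : ℕ, μ {a | N a = k ∧ X a ∈ D} := by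
  rw [← measure_iUnion]
  · congr 1
    ext a
    simp only [Set.mem_ofPred_eq, Set.mem_iUnion]
    constructor
    · rintro ⟨h1, h2⟩
      obtain ⟨k, hk⟩ := ENat.ne_top_iff_exists.1 h1.ne
      exact ⟨k, hk.symm, h2⟩
    · rintro ⟨k, h1, h2⟩
      exact ⟨h1 ▸ ENat.natCast_lt_top k, h2⟩
  · intro i j hij
    rw [Function.onFun, Set.disjoint_left]
    rintro a ⟨h1, -⟩ ⟨h2, -⟩
    exact hij (by exact_mod_cast h1.symm.trans h2)
  · exact fun k => (hN (measurableSet_singleton _)).inter (hX hD)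

/-- Two pairs of random variables, the first components being integer valued, have the same law
if they have the same law on the events where the first component takes a given value. -/
lemma ae_lt_top_and_map_eq {α β γ : Type*} [MeasurableSpace α] [MeasurableSpace β]
    [MeasurableSpace γ] {μ : Measure α} {ν : Measure β} [IsProbabilityMeasure μ]
    [IsProbabilityMeasure ν] {N : α → ℕ∞} {M : β → ℕ∞} (hN : Measurable N) (hM : Measurable M)
    {X : α → γ} {Y : β → γ} (hX : Measurable X) (hY : Measurable Y)
    (h : ∀ k : ℕ, ∀ D, MeasurableSet D → μ {a | N a = k ∧ X a ∈ D} = ν {b | M b = k ∧ Y b ∈ D})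
    (hM_fin : ∀ᵐ b ∂ν, M b < ⊤) : (∀ᵐ a ∂μ, N a < ⊤) ∧ μ.map X = ν.map Y := by
  have key : ∀ D, MeasurableSet D → μ {a | N a < ⊤ ∧ X a ∈ D} = ν {b | M b < ⊤ ∧ Y b ∈ D} := by
    intro D hD
    rw [measure_lt_top_and_mem μ hN hX hD, measure_lt_top_and_mem ν hM hY hD]
    exact tsum_congr fun k => h k D hD
  -- Taking `D` to be everything, the finite values of `N` carry the same mass as those of `M`,
  -- namely 1.
  have hN_fin : ∀ᵐ a ∂μ, N a < ⊤ := by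
    have h1 := key Set.univ MeasurableSet.univ
    simp only [Set.mem_univ, and_true] at h1
    have h2 : ν {b | M b < ⊤} = 1 := (mem_ae_iff_prob_eq_one (measurableSet_setOf_lt_top hM)).1 hM_fin
    exact (mem_ae_iff_prob_eq_one (measurableSet_setOf_lt_top hN)).2 (h1.trans h2)
  refine ⟨hN_fin, Measure.ext fun D hD => ?_⟩
  rw [Measure.map_apply hX hD, Measure.map_apply hY hD]
  have h1 : X ⁻¹' D =ᵐ[μ] {a | N a < ⊤ ∧ X a ∈ D} := by
    filter_upwards [hN_fin] with a ha
    exact propext ⟨fun h => ⟨ha, h⟩, fun h => h.2⟩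
  have h2 : Y ⁻¹' D =ᵐ[ν] {b | M b < ⊤ ∧ Y b ∈ D} := by
    filter_upwards [hM_fin] with b hb
    exact propext ⟨fun h => ⟨hb, h⟩, fun h => h.2⟩
  rw [measure_congr h1, measure_congr h2, key D hD]

variable {Ω : Type*} [MeasurableSpace Ω] {P : Measure Ω}
  {ξ : ℕ → Ω → E} {𝓛 : Kernel E (Measure ℝ)}

lemma measurable_env (hξ : ∀ n, Measurable (ξ n)) : Measurable (env ξ) :=
  measurable_pi_lambda _ hξ

lemma map_env (hξ : ∀ n, Measurable (ξ n)) (hind : iIndepFun ξ P)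
    (hid : ∀ n, IdentDistrib (ξ n) (ξ 0) P P) :
    P.map (env ξ) = Measure.infinitePi fun _ : ℕ => P.map (ξ 0) := by
  have h := hind.map_fun_eq_infinitePi_map hξ
  simp only [fun n => (hid n).map_eq] at h
  exact h

lemma annealedSteps_eq (hξ : ∀ n, Measurable (ξ n))
    (hid : ∀ n, IdentDistrib (ξ n) (ξ 0) P P) :
    annealedSteps P ξ 𝓛 = Measure.infinitePi fun _ : ℕ => annealedLaw (P.map (ξ 0)) 𝓛 := by
  have h : ∀ n, (P.bind fun ω => stepLaw 𝓛 (ξ n ω)) = annealedLaw (P.map (ξ 0)) 𝓛 := by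
    intro n
    rw [annealedLaw, ← (hid n).map_eq]
    ext s hs
    have hc := ((stepLaw 𝓛).measurable.comp (hξ n))
    rw [Measure.bind_apply hs (stepLaw 𝓛).aemeasurable,
      lintegral_map ((stepLaw 𝓛).measurable_coe hs) (hξ n)]
    exact Measure.bind_apply hs hc.aemeasurable
  simp only [annealedSteps, h]

lemma lintegral_env (hξ : ∀ n, Measurable (ξ n)) (hind : iIndepFun ξ P)
    (hid : ∀ n, IdentDistrib (ξ n) (ξ 0) P P) {f : (ℕ → E) → ℝ≥0∞} (hf : Measurable f) :
    ∫⁻ ω, f (env ξ ω) ∂P = ∫⁻ e, f e ∂(Measure.infinitePi fun _ : ℕ => P.map (ξ 0)) := by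
  rw [← map_env hξ hind hid, lintegral_map hf (measurable_env hξ)]

lemma measurable_harmonicU_left (𝓛 : Kernel E (Measure ℝ)) (y : ℝ) :
    Measurable fun e : ℕ → E => harmonicU 𝓛 e y :=
  (measurable_negExit_right y).lintegral_kernel

lemma tiltedAnnealed_apply (hξ : ∀ n, Measurable (ξ n)) (hind : iIndepFun ξ P)
    (hid : ∀ n, IdentDistrib (ξ n) (ξ 0) P P) {S : Set (ℕ → ℝ)} (hS : MeasurableSet S) :
    tiltedAnnealed P ξ 𝓛 S =
      (∫⁻ e, harmonicU 𝓛 e 0 * conditionedWalk 𝓛 e S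
        ∂(Measure.infinitePi fun _ : ℕ => P.map (ξ 0))) / meanU P ξ 𝓛 := by
  have hc : Measurable fun ω => conditionedWalk 𝓛 (env ξ ω) :=
    (conditionedWalk 𝓛).measurable.comp (measurable_env hξ)
  have hU := measurable_harmonicU_left 𝓛 0
  have hW : Measurable fun e => conditionedWalk 𝓛 e S := (conditionedWalk 𝓛).measurable_coe hS
  have hd : Measurable fun ω => harmonicU 𝓛 (env ξ ω) 0 / meanU P ξ 𝓛 :=
    (hU.comp (measurable_env hξ)).div_const _
  have hWe : Measurable fun ω => conditionedWalk 𝓛 (env ξ ω) S := hW.comp (measurable_env hξ)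
  rw [tiltedAnnealed, Measure.bind_apply hS hc.aemeasurable,
    lintegral_withDensity_eq_lintegral_mul _ hd hWe,
    ← lintegral_env hξ hind hid
      (f := fun e => harmonicU 𝓛 e 0 * conditionedWalk 𝓛 e S) (hU.mul hW), div_eq_mul_inv, ← lintegral_mul_const]
  · refine lintegral_congr fun ω => ?_
    simp only [Pi.mul_apply, div_eq_mul_inv]
    ring
  · exact (hU.mul hW).comp (measurable_env hξ)

/-- The bound x² ≤ 1 + |x|^(2+δ) turns the moment hypothesis into an annealed second moment, hence a
quenched one almost surely, which is what the centring condition needs to be meaningful. -/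
lemma centredEnv_of_boundary [IsProbabilityMeasure P] (hξ : Measurable (ξ 0))
    (h_pos : ∀ᵐ ω ∂P,
      0 < ∫⁻ L, ∫⁻ x in Set.Ioi 0, ENNReal.ofReal (Real.exp (-x)) ∂L ∂(𝓛 (ξ 0 ω)))
    (h_bdry₁ : ∀ᵐ ω ∂P, ∫⁻ L, ∫⁻ x, ENNReal.ofReal (Real.exp (-x)) ∂L ∂(𝓛 (ξ 0 ω)) = 1)
    (h_bdry₂ : ∀ᵐ ω ∂P, ∫ L, ∫ x, x * Real.exp (-x) ∂L ∂(𝓛 (ξ 0 ω)) = 0)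
    (δ : ℝ) (hδ : 0 < δ)
    (h_moment : ∫⁻ ω, ∫⁻ L, ∫⁻ x, ENNReal.ofReal (|x| ^ (2 + δ) * Real.exp (-x)) ∂L
      ∂(𝓛 (ξ 0 ω)) ∂P < ∞) :
    CentredEnv (P.map (ξ 0)) 𝓛 := by
  have hprob : IsProbabilityMeasure (P.map (ξ 0)) :=
    Measure.isProbabilityMeasure_map hξ.aemeasurable
  have hsqm : Measurable fun x : ℝ => ENNReal.ofReal (x ^ 2) := by fun_prop
  have hpm : Measurable fun x : ℝ => ENNReal.ofReal x := ENNReal.measurable_ofReal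
  have hnm : Measurable fun x : ℝ => ENNReal.ofReal (-x) := by fun_prop
  have hsq : ∫⁻ ω, ∫⁻ x, ENNReal.ofReal (x ^ 2) ∂(stepLaw 𝓛 (ξ 0 ω)) ∂P < ∞ := by
    refine lt_of_le_of_lt (lintegral_mono_ae (g := fun ω => 1 + ∫⁻ L, ∫⁻ x,
      ENNReal.ofReal (|x| ^ (2 + δ) * Real.exp (-x)) ∂L ∂(𝓛 (ξ 0 ω))) ?_) ?_
    · filter_upwards [h_bdry₁] with ω h1
      exact lintegral_sq_stepLaw_le hδ h1
    · rw [lintegral_add_left measurable_const, lintegral_const, measure_univ]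
      simpa using h_moment
  have hsqa : ∀ᵐ ω ∂P, ∫⁻ x, ENNReal.ofReal (x ^ 2) ∂(stepLaw 𝓛 (ξ 0 ω)) < ∞ :=
    ae_lt_top (hsqm.lintegral_kernel.comp hξ) hsq.ne
  refine ⟨?_, ?_, ?_⟩
  · rw [ae_map_iff hξ.aemeasurable
      (measurableSet_eq_fun hpm.lintegral_kernel hnm.lintegral_kernel)]
    filter_upwards [h_bdry₁, h_bdry₂, hsqa] with ω h1 h2 h3
    exact lintegral_stepLaw_eq_neg h1 h3 h2
  · rw [ae_map_iff hξ.aemeasurable (measurableSet_lt measurable_const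
      ((stepLaw 𝓛).measurable_coe measurableSet_Ioi))]
    filter_upwards [h_bdry₁, h_pos] with ω h1 h2
    rwa [stepLaw_Ioi h1]
  · rwa [lintegral_annealedLaw _ _ hsqm, lintegral_map hsqm.lintegral_kernel hξ]

end RWRE
end

/-! ### The annealed excursion theorem -/

theorem mainTheorem3 {E Ω : Type*} [MeasurableSpace E] [MeasurableSpace Ω]
    -- the environment: an i.i.d. sequence
    (P : Measure Ω) [IsProbabilityMeasure P] (ξ : ℕ → Ω → E)
    (hξ_meas : ∀ n, Measurable (ξ n)) (hξ_indep : iIndepFun ξ P)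
    (hξ_ident : ∀ n, IdentDistrib (ξ n) (ξ 0) P P)
    -- the point process law attached to each value of the environment
    (𝓛 : Kernel E (Measure ℝ)) [IsMarkovKernel 𝓛]
    (h_point : ∀ᵐ ω ∂P, ∀ᵐ L ∂(𝓛 (ξ 0 ω)), RWRE.IsPointMeasure L)
    -- non-extinction and non-triviality
    (h_nonext : ∀ᵐ ω ∂P, ∀ᵐ L ∂(𝓛 (ξ 0 ω)), 1 ≤ L Set.univ)
    (h_branch : 0 < P {ω | 0 < 𝓛 (ξ 0 ω) {L | 1 < L Set.univ}})
    (h_pos : ∀ᵐ ω ∂P,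
      0 < ∫⁻ L, ∫⁻ x in Set.Ioi 0, ENNReal.ofReal (Real.exp (-x)) ∂L ∂(𝓛 (ξ 0 ω)))
    -- the boundary case
    (h_bdry₁ : ∀ᵐ ω ∂P, ∫⁻ L, ∫⁻ x, ENNReal.ofReal (Real.exp (-x)) ∂L ∂(𝓛 (ξ 0 ω)) = 1)
    (h_bdry₂ : ∀ᵐ ω ∂P, ∫ L, ∫ x, x * Real.exp (-x) ∂L ∂(𝓛 (ξ 0 ω)) = 0)
    -- the moment condition
    (δ : ℝ) (hδ : 0 < δ)
    (h_moment : ∫⁻ ω, ∫⁻ L, ∫⁻ x, ENNReal.ofReal (|x| ^ (2 + δ) * Real.exp (-x)) ∂L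
      ∂(𝓛 (ξ 0 ω)) ∂P < ∞) :
    -- all objects are well defined
    (0 < RWRE.meanU P ξ 𝓛 ∧ RWRE.meanU P ξ 𝓛 < ∞) ∧
    IsProbabilityMeasure (RWRE.tiltedAnnealed P ξ 𝓛) ∧
    (∀ᵐ ζ ∂(RWRE.tiltedAnnealed P ξ 𝓛), RWRE.prospectiveMin ζ < ⊤) ∧
    (∀ᵐ X ∂(RWRE.annealedSteps P ξ 𝓛), RWRE.ladderEpoch (RWRE.walk X) < ⊤) ∧
    -- the law of `ζ_ν` is the law of `S_{Γ₁}`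
    IdentDistrib (fun ζ : ℕ → ℝ => ζ (RWRE.prospectiveMin ζ).toNat)
      (fun X : ℕ → ℝ => RWRE.walk X (RWRE.ladderEpoch (RWRE.walk X)).toNat)
      (RWRE.tiltedAnnealed P ξ 𝓛) (RWRE.annealedSteps P ξ 𝓛) ∧
    -- the law of the pre-minimum excursion
    IdentDistrib RWRE.preMinExcursion (fun X => RWRE.reversedLadderExcursion (RWRE.walk X))
      (RWRE.tiltedAnnealed P ξ 𝓛) (RWRE.annealedSteps P ξ 𝓛) ∧
    (∀ f : RWRE.FinSeq → ℝ≥0∞, Measurable f →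
      ∫⁻ ζ, f (RWRE.preMinExcursion ζ) ∂(RWRE.tiltedAnnealed P ξ 𝓛) =
        ∫⁻ X, f (RWRE.reversedLadderExcursion (RWRE.walk X)) ∂(RWRE.annealedSteps P ξ 𝓛)) ∧
    (∀ f : RWRE.FinSeq → ℝ, Measurable f →
      (Integrable (fun ζ => f (RWRE.preMinExcursion ζ)) (RWRE.tiltedAnnealed P ξ 𝓛) ↔
        Integrable (fun X => f (RWRE.reversedLadderExcursion (RWRE.walk X)))
          (RWRE.annealedSteps P ξ 𝓛)) ∧
      ∫ ζ, f (RWRE.preMinExcursion ζ) ∂(RWRE.tiltedAnnealed P ξ 𝓛) =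
        ∫ X, f (RWRE.reversedLadderExcursion (RWRE.walk X)) ∂(RWRE.annealedSteps P ξ 𝓛)) := by
  have hcent : RWRE.CentredEnv (P.map (ξ 0)) 𝓛 :=
    RWRE.centredEnv_of_boundary (hξ_meas 0) h_pos h_bdry₁ h_bdry₂ δ hδ h_moment
  have hη : IsProbabilityMeasure (P.map (ξ 0)) :=
    Measure.isProbabilityMeasure_map (hξ_meas 0).aemeasurable
  have hU : RWRE.meanU P ξ 𝓛 =
      ∫⁻ e, RWRE.harmonicU 𝓛 e 0 ∂(Measure.infinitePi fun _ : ℕ => P.map (ξ 0)) :=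
    RWRE.lintegral_env hξ_meas hξ_indep hξ_ident (RWRE.measurable_harmonicU_left 𝓛 0)
  have hU0 : 0 < RWRE.meanU P ξ 𝓛 := hU ▸ hcent.lintegral_harmonicU_pos
  have hU1 : RWRE.meanU P ξ 𝓛 < ∞ := hU ▸ hcent.lintegral_harmonicU_lt_top
  have hsteps := RWRE.annealedSteps_eq (𝓛 := 𝓛) hξ_meas hξ_ident
  have hprob : IsProbabilityMeasure (RWRE.tiltedAnnealed P ξ 𝓛) := by
    refine ⟨?_⟩
    rw [RWRE.tiltedAnnealed_apply hξ_meas hξ_indep hξ_ident MeasurableSet.univ]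
    simp only [measure_univ, mul_one]
    rw [← hU, ENNReal.div_self hU0.ne' hU1.ne]
  have hprob' : IsProbabilityMeasure (RWRE.annealedSteps P ξ 𝓛) := by
    rw [hsteps]; infer_instance
  have hladder : ∀ᵐ X ∂(RWRE.annealedSteps P ξ 𝓛), RWRE.ladderEpoch (RWRE.walk X) < ⊤ := by
    rw [hsteps]
    exact RWRE.ae_ladderEpoch_lt_top _ hcent.integrable hcent.integral_eq_zero hcent.sq_lt_top
      hcent.annealedLaw_pos
  have hrev : Measurable fun X : ℕ → ℝ => RWRE.reversedLadderExcursion (RWRE.walk X) :=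
    RWRE.measurable_reversedLadderExcursion.comp RWRE.measurable_walk_path
  obtain ⟨hmin, hmap⟩ := RWRE.ae_lt_top_and_map_eq (μ := RWRE.tiltedAnnealed P ξ 𝓛)
    (ν := RWRE.annealedSteps P ξ 𝓛) RWRE.measurable_prospectiveMin
    (RWRE.measurable_ladderEpoch.comp RWRE.measurable_walk_path)
    RWRE.measurable_preMinExcursion hrev (fun k D hD => by
      -- Both times are at least 1, so the events for `k = 0` are empty.
      rcases Nat.eq_zero_or_pos k with rfl | hk
      · have h1 : {ζ | RWRE.prospectiveMin ζ = (0 : ℕ) ∧ RWRE.preMinExcursion ζ ∈ D} = ∅ :=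
          Set.eq_empty_of_forall_notMem fun ζ h =>
            absurd (RWRE.prospectiveMin_eq_coe_iff.1 h.1).1.1 (by omega)
        have h2 : {X | RWRE.ladderEpoch (RWRE.walk X) = (0 : ℕ) ∧
            RWRE.reversedLadderExcursion (RWRE.walk X) ∈ D} = ∅ :=
          Set.eq_empty_of_forall_notMem fun X h =>
            absurd (RWRE.ladderEpoch_walk_eq_coe_iff.1 h.1).1 (by omega)
        simp only [Function.comp_apply]
        rw [h1, h2, measure_empty, measure_empty]
      · have hS : MeasurableSet {ζ | RWRE.prospectiveMin ζ = k ∧ RWRE.preMinExcursion ζ ∈ D} :=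
          (RWRE.measurable_prospectiveMin (measurableSet_singleton _)).inter
            (RWRE.measurable_preMinExcursion hD)
        rw [RWRE.tiltedAnnealed_apply hξ_meas hξ_indep hξ_ident hS,
          hcent.lintegral_harmonicU_mul_conditionedWalk hk hD, ← hU, hsteps,
          ENNReal.mul_div_cancel_right hU0.ne' hU1.ne]
        rfl) hladder
  have hI : IdentDistrib RWRE.preMinExcursion
      (fun X => RWRE.reversedLadderExcursion (RWRE.walk X))
      (RWRE.tiltedAnnealed P ξ 𝓛) (RWRE.annealedSteps P ξ 𝓛) :=
    ⟨RWRE.measurable_preMinExcursion.aemeasurable, hrev.aemeasurable, hmap⟩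
  refine ⟨⟨hU0, hU1⟩, hprob, hmin, hladder, ?_, hI, fun f hf => (hI.comp hf).lintegral_eq,
    fun f hf => ⟨(hI.comp hf).integrable_iff, (hI.comp hf).integral_eq⟩⟩
  -- The law of ζ_ν is the image of the excursion law under the last entry; the conventions for
  -- infinite times matter only on null sets.
  have hlast := hI.comp RWRE.measurable_lastEntry
  have h1 : RWRE.lastEntry ∘ RWRE.preMinExcursion =ᵐ[RWRE.tiltedAnnealed P ξ 𝓛]
      fun ζ => ζ (RWRE.prospectiveMin ζ).toNat := by
    filter_upwards [hmin] with ζ hζ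
    exact RWRE.lastEntry_preMinExcursion hζ
  have h2 : (RWRE.lastEntry ∘ fun X => RWRE.reversedLadderExcursion (RWRE.walk X))
      =ᵐ[RWRE.annealedSteps P ξ 𝓛]
        fun X => RWRE.walk X (RWRE.ladderEpoch (RWRE.walk X)).toNat := by
    filter_upwards [hladder] with X hX
    exact RWRE.lastEntry_reversedLadderExcursion hX
  exact ((IdentDistrib.of_ae_eq hlast.aemeasurable_fst h1).symm.trans hlast).trans
    (IdentDistrib.of_ae_eq hlast.aemeasurable_snd h2)
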